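/- Let $G$ be a locally compact, second countable, Hausdorff, unimodular group with Haar measure $m$. Fix a non-empty open set $U\subseteq G$ and a compact set $K\subseteq G$. A $(U,K)$-Delone set is a non-empty set $D\subseteq G$ such that $\#(gU\cap D)\le 1$ for all $g\in G$ and $D\cdot K=G$; such a set is closed. For a locally compact, second countable, Hausdorff space $Z$, the Chabauty–Fell topology on the closed subsets of $Z$ has as a basis the sets $\{Y : C\cap Y=\emptyset,\ O\cap Y\ne\emptyset \text{ for all } O\in\mathcal O\}$ with $C\subseteq Z$ compact and $\mathcal O$ a finite family of open subsets of $Z$. Let $\mathcal D$ be the space of all $(U,K)$-Delone sets with the topology induced by the Chabauty–Fell topology on the closed subsets of $G$; the group $G$ acts on $\mathcal D$ by translation. A Delone dynamical system is a non-empty, closed, $G$-invariant set $\Omega\subseteq\mathcal D$; it is uniquely ergodic with measure $\mu$ if $\mu$ is the only $G$-invariant Borel probability measure on $\Omega$. A kernel of finite type is a bounded continuous function $a$ on $\{(x,D,y) : D\in\mathcal D,\ x,y\in D\}\subseteq G\times\mathcal D\times G$ with $a(gx,gD,gy)=a(x,D,y)$ for all $g\in G$ and for which there is a compact set $S=S^{-1}\subseteq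 G$ with $a(x,D,y)=0$ whenever $x^{-1}y\notin S$. It defines bounded operators $(\lambda^D(a)u)(x)=\sum_{y\in D}a(x,D,y)u(y)$ on $\ell^2(D)$, $D\in\mathcal D$. A random bounded operator is a family $A=(A_D)_{D\in\mathcal D}$ in the completion of the families $(\lambda^D(a))_{D}$, $a$ a kernel of finite type, with respect to the norm $\sup_{D}\|A_D\|$. It is self-adjoint if every $A_D$ is self-adjoint. For a self-adjoint random bounded operator $A$, a Delone dynamical system $\Omega$ and a $G$-invariant Borel probability measure $\mu$ on $\Omega$, the density of states $\eta^A_{\Omega,\mu}$ is the Radon measure on $\mathbb R$ with $$\int_{\mathbb R}\phi\,d\eta^A_{\Omega,\mu}=\int_\Omega\sum_{x\in D}\rho(x)\,\langle\delta_x,\phi(A_D)\delta_x\rangle\,d\mu(D)\qquad\text{for all }\phi\in C_c(\mathbb R)$$ and for every non-negative $\rho\in C_c(G)$ with $\int_G\rho\,dm=1$. **Corollary.** Let $\Omega$ be a uniquely ergodic Delone dynamical system with measure $\mu$. Let $\Omega_l$, $l\in\mathbb N$, be Delone dynamical systems with $G$-invariant Borel probability measures $\mu_l$ on $\Omega_l$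 such that $\Omega_l\to\Omega$ in the Chabauty–Fell topology on the closed subsets of $\mathcal D$. Let $A$ be a self-adjoint random bounded operator. Then the densities of states $\eta^A_{\Omega_l,\mu_l}$ and $\eta^A_{\Omega,\mu}$ exist and are unique, and $\eta^A_{\Omega_l,\mu_l}\to\eta^A_{\Omega,\mu}$ in the weak-$*$ topology, that is, $$\lim_{l\to\infty}\int_{\mathbb R}\phi\,d\eta^A_{\Omega_l,\mu_l}=\int_{\mathbb R}\phi\,d\eta^A_{\Omega,\mu}\qquad\text{for all }\phi\in C_c(\mathbb R).$$ -/

import Mathlib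

open scoped ENNReal Pointwise CompactlySupported
open Filter Topology MeasureTheory TopologicalSpace

noncomputable section

namespace DeloneDOS

/-! ### The Chabauty–Fell topology -/

/-- The Chabauty–Fell topology on the closed subsets of `Z`, generated by the sets
`𝒱(C, 𝒪) = {Y | C ∩ Y = ∅ and O ∩ Y ≠ ∅ for all O ∈ 𝒪}`, where `C` is compact and `𝒪` is a finite
family of open sets. -/
abbrev chabautyFell (Z : Type*) [TopologicalSpace Z] : TopologicalSpace (Closeds Z) :=
  generateFrom {V | ∃ (C : Set Z) (𝒪 : Set (Set Z)), IsCompact C ∧ 𝒪.Finite ∧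
    (∀ O ∈ 𝒪, IsOpen O) ∧
    V = {Y : Closeds Z | C ∩ (Y : Set Z) = ∅ ∧ ∀ O ∈ 𝒪, (O ∩ (Y : Set Z)).Nonempty}}

/-! ### Delone sets -/

section Delone

variable (G : Type*) [Group G] [TopologicalSpace G]

/-- The two parameters of Delone sets: an open set `U` and a compact set `K` in `G`. The set `U` is
non-empty, since otherwise uniform discreteness with respect to `U` would be an empty condition. -/
structure DeloneParameters where
  U : Set G
  K : Set G
  isOpen_U : IsOpen U
  nonempty_U : U.Nonempty
  isCompact_K : IsCompact K

variable {G}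

/-- `D` is a `(U, K)`-Delone set: it is non-empty, `U`-left uniformly discrete (every translate
`gU` contains at most one point of `D`) and `K`-left relatively dense (`D · K = G`). -/
structure IsDelone (P : DeloneParameters G) (D : Set G) : Prop where
  nonempty : D.Nonempty
  uniformlyDiscrete : ∀ g : G, ((g • P.U) ∩ D).Subsingleton
  relativelyDense : D * P.K = Set.univ

/-- The space of `(U, K)`-Delone sets in `G`. Such sets are automatically closed, so they are
recorded as points of the space of closed subsets of `G`. -/
@[ext]
structure DeloneSet (P : DeloneParameters G) where
  carrier : Closeds G
  isDelone : IsDelone P (carrier : Set G)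

variable {P : DeloneParameters G}

instance : Membership G (DeloneSet P) := ⟨fun D x => x ∈ D.carrier⟩

/-- The topology induced by the Chabauty–Fell topology on the closed subsets of `G`. -/
instance : TopologicalSpace (DeloneSet P) :=
  TopologicalSpace.induced DeloneSet.carrier (chabautyFell G)

instance : MeasurableSpace (DeloneSet P) := borel (DeloneSet P)

instance : BorelSpace (DeloneSet P) := ⟨rfl⟩

/-- The points of a Delone set, as a type. -/
abbrev DeloneSet.Pts (D : DeloneSet P) : Type _ := {x : G // x ∈ D}

lemma IsDelone.smul {D : Set G} (hD : IsDelone P D) (g : G) : IsDelone P (g • D) where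
  nonempty := hD.nonempty.smul_set
  uniformlyDiscrete h := by
    rintro _ ⟨hxU, x, hxD, rfl⟩ _ ⟨hyU, y, hyD, rfl⟩
    have key : ∀ z : G, g • z ∈ h • P.U → z ∈ (g⁻¹ * h) • P.U := by
      intro z hz
      rw [mul_smul, Set.mem_smul_set_iff_inv_smul_mem, inv_inv]
      exact hz
    have := hD.uniformlyDiscrete (g⁻¹ * h) ⟨key x hxU, hxD⟩ ⟨key y hyU, hyD⟩
    simp only [this]
  relativelyDense := by
    rw [smul_mul_assoc, hD.relativelyDense, Set.smul_set_univ]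

variable [IsTopologicalGroup G]

/-- A uniformly discrete set is closed, hence no Delone set is lost by recording closed sets. -/
lemma IsDelone.isClosed [T1Space G] {D : Set G} (hD : IsDelone P D) : IsClosed D := by
  obtain ⟨u, hu⟩ := P.nonempty_U
  rw [← isOpen_compl_iff, isOpen_iff_mem_nhds]
  intro x hx
  have hV : (x * u⁻¹) • P.U ∈ 𝓝 x :=
    (P.isOpen_U.smul (x * u⁻¹)).mem_nhds ⟨u, hu, by simp⟩
  by_cases h : (((x * u⁻¹) • P.U) ∩ D).Nonempty
  · obtain ⟨y, hyV, hyD⟩ := h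
    have hxy : x ≠ y := fun h => hx (h ▸ hyD)
    filter_upwards [hV, isOpen_compl_singleton.mem_nhds hxy] with z hzV hz hzD
    exact hz (hD.uniformlyDiscrete _ ⟨hzV, hzD⟩ ⟨hyV, hyD⟩)
  · filter_upwards [hV] with z hzV hzD
    exact h ⟨z, hzV, hzD⟩

/-- The translation action `(g, D) ↦ gD` on Delone sets. -/
instance : SMul G (DeloneSet P) :=
  ⟨fun g D => ⟨⟨g • (D.carrier : Set G), D.carrier.isClosed.smul g⟩, D.isDelone.smul g⟩⟩

lemma DeloneSet.coe_smul (g : G) (D : DeloneSet P) :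
    ((g • D).carrier : Set G) = g • (D.carrier : Set G) := rfl

instance : MulAction G (DeloneSet P) where
  one_smul D := by
    apply DeloneSet.ext
    apply SetLike.coe_injective
    rw [DeloneSet.coe_smul, one_smul]
  mul_smul g h D := by
    apply DeloneSet.ext
    apply SetLike.coe_injective
    rw [DeloneSet.coe_smul, DeloneSet.coe_smul, DeloneSet.coe_smul, mul_smul]

lemma DeloneSet.smul_mem_smul (g : G) {x : G} {D : DeloneSet P} (hx : x ∈ D) :
    g * x ∈ g • D :=
  Set.smul_mem_smul_set (a := g) (s := (D.carrier : Set G)) hx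

/-! ### Delone dynamical systems -/

/-- `Ω` is a Delone dynamical system: a non-empty, closed, `G`-invariant set of
`(U, K)`-Delone sets. -/
structure IsDeloneSystem (Ω : Closeds (DeloneSet P)) : Prop where
  nonempty : (Ω : Set (DeloneSet P)).Nonempty
  smul_mem : ∀ (g : G) (D : DeloneSet P), D ∈ Ω → g • D ∈ Ω

/-- `μ` is a `G`-invariant Borel probability measure on `Ω`, seen as a measure on the space of all
`(U, K)`-Delone sets that gives no mass to the complement of `Ω`. -/
structure IsInvariantProbability (Ω : Closeds (DeloneSet P)) (μ : Measure (DeloneSet P)) :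
    Prop where
  isProbabilityMeasure : IsProbabilityMeasure μ
  compl_eq_zero : μ (Ω : Set (DeloneSet P))ᶜ = 0
  invariant : ∀ g : G, μ.map (fun D => g • D) = μ

/-- `μ` is the only `G`-invariant Borel probability measure on `Ω`. -/
structure IsUniquelyErgodic (Ω : Closeds (DeloneSet P)) (μ : Measure (DeloneSet P)) : Prop where
  isInvariantProbability : IsInvariantProbability Ω μ
  eq_of_isInvariantProbability : ∀ ν : Measure (DeloneSet P), IsInvariantProbability Ω ν → ν = μ

/-! ### Kernels of finite type -/

variable (P) in
/-- The space of all `(x, D, y)` with `D` a Delone set and `x, y ∈ D`, with the topology induced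
from `G × DeloneSet P × G`. -/
abbrev KernelDomain : Type _ :=
  {p : G × DeloneSet P × G // p.1 ∈ p.2.1 ∧ p.2.2 ∈ p.2.1}

/-- The diagonal translation `(x, D, y) ↦ (gx, gD, gy)`. -/
def KernelDomain.translate (g : G) (p : KernelDomain P) : KernelDomain P :=
  ⟨(g * p.1.1, g • p.1.2.1, g * p.1.2.2),
    DeloneSet.smul_mem_smul g p.2.1, DeloneSet.smul_mem_smul g p.2.2⟩

variable (P) in
/-- A kernel of finite type: a continuous function `a(x, D, y)` which is bounded, of finite range,
and invariant under diagonal translation. -/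
structure FiniteTypeKernel where
  toFun : KernelDomain P → ℂ
  continuous_toFun : Continuous toFun
  bounded : ∃ C : ℝ, ∀ p, ‖toFun p‖ ≤ C
  finiteRange : ∃ S : Set G, IsCompact S ∧ S⁻¹ = S ∧
    ∀ p : KernelDomain P, p.1.1⁻¹ * p.1.2.2 ∉ S → toFun p = 0
  invariant : ∀ (g : G) (p : KernelDomain P), toFun (KernelDomain.translate g p) = toFun p

/-- The matrix `(x, y) ↦ a(x, D, y)` indexed by the points of `D`. -/
def FiniteTypeKernel.matrix (a : FiniteTypeKernel P) (D : DeloneSet P) (x y : D.Pts) : ℂ :=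
  a.toFun ⟨(x.1, D, y.1), x.2, y.2⟩

/-! ### The operators defined by kernels of finite type -/

/-- The Hilbert space `ℓ²(D)`. -/
abbrev DeloneSet.L2 (D : DeloneSet P) : Type _ := lp (fun _ : D.Pts => ℂ) 2

/-- Schur's test for a matrix with bounded entries and at most `N` non-zero entries in every row
and column. -/
lemma schur_sum_le {ι : Type*} (k : ι → ι → ℂ) (F : ι → Finset ι) (N : ℕ) (C : ℝ)
    (hF : ∀ x y, y ∉ F x → k x y = 0) (hsymm : ∀ x y, y ∈ F x → x ∈ F y)
    (hN : ∀ x, (F x).card ≤ N) (hC : ∀ x y, ‖k x y‖ ≤ C)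
    (u : lp (fun _ : ι => ℂ) 2) (s : Finset ι) :
    ∑ x ∈ s, ‖∑' y, k x y * u y‖ ^ (2 : ℝ≥0∞).toReal ≤ (N * C * ‖u‖) ^ (2 : ℝ≥0∞).toReal := by
  classical
  have hu : ∀ t : Finset ι, ∑ y ∈ t, ‖u y‖ ^ 2 ≤ ‖u‖ ^ 2 := by
    intro t
    have := lp.sum_rpow_le_norm_rpow (p := 2) (by norm_num) u t
    simpa using this
  have h2 : (2 : ℝ≥0∞).toReal = ((2 : ℕ) : ℝ) := by norm_num
  simp only [h2, Real.rpow_natCast]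
  have hrow : ∀ x, ‖∑' y, k x y * u y‖ ^ 2 ≤ N * C ^ 2 * ∑ y ∈ F x, ‖u y‖ ^ 2 := by
    intro x
    rw [tsum_eq_sum (s := F x) (fun y hy => by rw [hF x y hy, zero_mul])]
    have h1 : ‖∑ y ∈ F x, k x y * u y‖ ≤ ∑ y ∈ F x, C * ‖u y‖ := by
      refine (norm_sum_le _ _).trans (Finset.sum_le_sum fun y _ => ?_)
      rw [norm_mul]
      exact mul_le_mul_of_nonneg_right (hC x y) (norm_nonneg _)
    have h3 : (∑ y ∈ F x, ‖u y‖) ^ 2 ≤ N * ∑ y ∈ F x, ‖u y‖ ^ 2 := by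
      refine (sq_sum_le_card_mul_sum_sq (s := F x) (f := fun y => ‖u y‖)).trans ?_
      have : ((F x).card : ℝ) ≤ N := by exact_mod_cast hN x
      exact mul_le_mul_of_nonneg_right this (Finset.sum_nonneg fun _ _ => sq_nonneg _)
    calc ‖∑ y ∈ F x, k x y * u y‖ ^ 2 ≤ (∑ y ∈ F x, C * ‖u y‖) ^ 2 := by gcongr
      _ = C ^ 2 * (∑ y ∈ F x, ‖u y‖) ^ 2 := by rw [← Finset.mul_sum, mul_pow]
      _ ≤ C ^ 2 * (N * ∑ y ∈ F x, ‖u y‖ ^ 2) := by gcongr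
      _ = _ := by ring
  have hswap : ∑ x ∈ s, ∑ y ∈ F x, ‖u y‖ ^ 2 ≤ N * ‖u‖ ^ 2 := by
    rw [Finset.sum_comm' (t' := s.biUnion F) (s' := fun y => s.filter fun x => y ∈ F x)
      (by intro x y; simp only [Finset.mem_filter, Finset.mem_biUnion]; grind)]
    calc ∑ y ∈ s.biUnion F, ∑ _x ∈ s.filter (fun x => y ∈ F x), ‖u y‖ ^ 2
        ≤ ∑ y ∈ s.biUnion F, N * ‖u y‖ ^ 2 := by
          refine Finset.sum_le_sum fun y _ => ?_
          rw [Finset.sum_const, nsmul_eq_mul]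
          have : (s.filter fun x => y ∈ F x).card ≤ N :=
            (Finset.card_le_card fun x hx => hsymm x y (Finset.mem_filter.1 hx).2).trans (hN y)
          gcongr
      _ = N * ∑ y ∈ s.biUnion F, ‖u y‖ ^ 2 := by rw [Finset.mul_sum]
      _ ≤ _ := by gcongr; exact hu _
  calc ∑ x ∈ s, ‖∑' y, k x y * u y‖ ^ 2 ≤ ∑ x ∈ s, N * C ^ 2 * ∑ y ∈ F x, ‖u y‖ ^ 2 :=
        Finset.sum_le_sum fun x _ => hrow x
    _ = N * C ^ 2 * ∑ x ∈ s, ∑ y ∈ F x, ‖u y‖ ^ 2 := by rw [Finset.mul_sum]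
    _ ≤ N * C ^ 2 * (N * ‖u‖ ^ 2) := by gcongr
    _ = _ := by ring

/-- Translates of a fixed compact set contain a bounded number of points of a Delone set. -/
lemma exists_card_le (P : DeloneParameters G) {S : Set G} (hS : IsCompact S) :
    ∃ N : ℕ, ∀ (D : DeloneSet P) (x : D.Pts), ∃ F : Finset D.Pts,
      (∀ y, y ∈ F ↔ x.1⁻¹ * y.1 ∈ S) ∧ F.card ≤ N := by
  classical
  obtain ⟨u, hu⟩ := P.nonempty_U
  obtain ⟨b, -, hb, hcov⟩ := hS.elim_finite_subcover_image (b := Set.univ)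
    (c := fun s : G => (s * u⁻¹) • P.U) (fun s _ => P.isOpen_U.smul _)
    (fun s _ => Set.mem_biUnion (Set.mem_univ s) ⟨u, hu, by simp⟩)
  refine ⟨hb.toFinset.card, fun D x => ?_⟩
  have hex : ∀ y : D.Pts, x.1⁻¹ * y.1 ∈ S → ∃ s ∈ b, x.1⁻¹ * y.1 ∈ (s * u⁻¹) • P.U := by
    intro y hy
    simpa using hcov hy
  choose! f hfb hfU using hex
  have hinj : Set.InjOn f {y : D.Pts | x.1⁻¹ * y.1 ∈ S} := by
    intro y hy z hz hyz
    have key : ∀ w : D.Pts, x.1⁻¹ * w.1 ∈ S → w.1 ∈ (x.1 * (f w * u⁻¹)) • P.U := by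
      intro w hw
      rw [mul_smul, Set.mem_smul_set_iff_inv_smul_mem]
      exact hfU w hw
    have hz' := key z hz
    rw [← hyz] at hz'
    exact Subtype.ext (D.isDelone.uniformlyDiscrete _ ⟨key y hy, y.2⟩ ⟨hz', z.2⟩)
  have hfin : {y : D.Pts | x.1⁻¹ * y.1 ∈ S}.Finite :=
    Set.Finite.of_finite_image (hb.subset (by rintro _ ⟨y, hy, rfl⟩; exact hfb y hy)) hinj
  refine ⟨hfin.toFinset, fun y => by simp, ?_⟩
  refine Finset.card_le_card_of_injOn f (fun y hy => ?_) (fun y hy z hz h => ?_)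
  · simpa using hfb y (by simpa using hy)
  · exact hinj (by simpa using hy) (by simpa using hz) h

/-- All data needed to apply Schur's test to a kernel of finite type. -/
lemma FiniteTypeKernel.exists_rows (a : FiniteTypeKernel P) :
    ∃ (N : ℕ) (C : ℝ), 0 ≤ C ∧ ∀ D : DeloneSet P, ∃ F : D.Pts → Finset D.Pts,
      (∀ x y, y ∉ F x → a.matrix D x y = 0) ∧ (∀ x y, y ∈ F x → x ∈ F y) ∧
      (∀ x, (F x).card ≤ N) ∧ ∀ x y, ‖a.matrix D x y‖ ≤ C := by
  obtain ⟨C, hC⟩ := a.bounded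
  obtain ⟨S, hS, hinv, hrange⟩ := a.finiteRange
  obtain ⟨N, hN⟩ := exists_card_le P hS
  refine ⟨N, |C|, abs_nonneg C, fun D => ?_⟩
  choose F hF hcard using hN D
  refine ⟨F, fun x y hy => hrange _ fun h => hy ((hF x y).2 h), fun x y hy => ?_, hcard,
    fun x y => (hC _).trans (le_abs_self C)⟩
  have h := (hF x y).1 hy
  rw [hF y x, ← hinv, Set.mem_inv]
  simpa using h

/-- `∑ y ∈ D, a(x, D, y) u(y)`, a sum with finitely many non-zero terms. -/
def FiniteTypeKernel.apply (a : FiniteTypeKernel P) (D : DeloneSet P) (u : D.L2) (x : D.Pts) : ℂ :=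
  ∑' y : D.Pts, a.matrix D x y * u y

lemma FiniteTypeKernel.exists_apply_le (a : FiniteTypeKernel P) :
    ∃ M : ℝ, 0 ≤ M ∧ ∀ (D : DeloneSet P) (u : D.L2) (s : Finset D.Pts),
      ∑ x ∈ s, ‖a.apply D u x‖ ^ (2 : ℝ≥0∞).toReal ≤ (M * ‖u‖) ^ (2 : ℝ≥0∞).toReal := by
  obtain ⟨N, C, hC0, h⟩ := a.exists_rows
  refine ⟨N * C, by positivity, fun D u s => ?_⟩
  obtain ⟨F, h1, h2, h3, h4⟩ := h D
  exact schur_sum_le (a.matrix D) F N C h1 h2 h3 h4 u s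

lemma FiniteTypeKernel.summable_apply (a : FiniteTypeKernel P) (D : DeloneSet P) (u : D.L2)
    (x : D.Pts) : Summable fun y : D.Pts => a.matrix D x y * u y := by
  obtain ⟨N, C, hC0, h⟩ := a.exists_rows
  obtain ⟨F, h1, -⟩ := h D
  exact summable_of_ne_finset_zero (s := F x) fun y hy => by rw [h1 x y hy, zero_mul]

/-- The operator `(λ^D(a) u)(x) = ∑ y ∈ D, a(x, D, y) u(y)` as a linear map on `ℓ²(D)`. -/
def FiniteTypeKernel.linearMap (a : FiniteTypeKernel P) (D : DeloneSet P) : D.L2 →ₗ[ℂ] D.L2 where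
  toFun u := ⟨a.apply D u, memℓp_gen' (a.exists_apply_le.choose_spec.2 D u)⟩
  map_add' u v := by
    ext x
    change ∑' y : D.Pts, a.matrix D x y * (u + v) y =
      (∑' y : D.Pts, a.matrix D x y * u y) + ∑' y : D.Pts, a.matrix D x y * v y
    rw [← (a.summable_apply D u x).tsum_add (a.summable_apply D v x)]
    exact tsum_congr fun y => by rw [lp.coeFn_add, Pi.add_apply, mul_add]
  map_smul' c u := by
    ext x
    change ∑' y : D.Pts, a.matrix D x y * (c • u) y = c * ∑' y : D.Pts, a.matrix D x y * u y
    rw [← tsum_mul_left]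
    exact tsum_congr fun y => by rw [lp.coeFn_smul, Pi.smul_apply, smul_eq_mul, mul_left_comm]

lemma FiniteTypeKernel.exists_norm_linearMap_le (a : FiniteTypeKernel P) :
    ∃ M : ℝ, 0 ≤ M ∧ ∀ (D : DeloneSet P) (u : D.L2), ‖a.linearMap D u‖ ≤ M * ‖u‖ := by
  obtain ⟨M, hM0, hM⟩ := a.exists_apply_le
  exact ⟨M, hM0, fun D u => lp.norm_le_of_forall_sum_le (by norm_num) (by positivity) (hM D u)⟩

/-- The bounded operator `λ^D(a)` on `ℓ²(D)`, given by
`(λ^D(a) u)(x) = ∑ y ∈ D, a(x, D, y) u(y)`. -/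
def FiniteTypeKernel.op (a : FiniteTypeKernel P) (D : DeloneSet P) : D.L2 →L[ℂ] D.L2 :=
  (a.linearMap D).mkContinuousOfExistsBound
    (a.exists_norm_linearMap_le.imp fun _ h => h.2 D)

lemma FiniteTypeKernel.op_apply (a : FiniteTypeKernel P) (D : DeloneSet P) (u : D.L2)
    (x : D.Pts) : a.op D u x = ∑' y : D.Pts, a.matrix D x y * u y := rfl

/-! ### Random bounded operators -/

variable (P) in
/-- The C*-algebra of all uniformly bounded families `(A_D)_D` of operators on the Hilbert spaces
`ℓ²(D)`, with pointwise operations and the norm `sup_D ‖A_D‖`. -/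
abbrev BoundedFamily : Type _ := lp (fun D : DeloneSet P => D.L2 →L[ℂ] D.L2) ∞

/-- The family `(λ^D(a))_D` of a kernel `a` of finite type. -/
def FiniteTypeKernel.family (a : FiniteTypeKernel P) : BoundedFamily P :=
  ⟨fun D => a.op D, by
    obtain ⟨M, hM0, hM⟩ := a.exists_norm_linearMap_le
    refine memℓp_infty ⟨M, ?_⟩
    rintro _ ⟨D, rfl⟩
    exact ContinuousLinearMap.opNorm_le_bound _ hM0 (hM D)⟩

variable (P) in
/-- The completion of the kernels of finite type in the norm `sup_D ‖λ^D(a)‖`, realised as the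
closure of `{(λ^D(a))_D}` in the complete space of bounded families. Its elements are the random
bounded operators. -/
def randomBoundedOperators : Set (BoundedFamily P) :=
  closure (Set.range (FiniteTypeKernel.family (P := P)))

/-! ### The density of states -/

open Classical in
/-- The function `D ↦ ∑ x ∈ D, ρ(x) ⟨δ_x, φ(A_D) δ_x⟩`. The operator `φ(A_D)` is given by the
continuous functional calculus of the self-adjoint operator `A_D`, whose spectrum is real. -/
def localTrace (A : BoundedFamily P) (ρ : C_c(G, ℝ)) (φ : C_c(ℝ, ℂ)) (D : DeloneSet P) : ℂ :=
  ∑' x : D.Pts, (ρ x.1 : ℂ) *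
    inner ℂ (lp.single 2 x (1 : ℂ) : D.L2)
      (cfc (fun z : ℂ => φ z.re) (A D) (lp.single 2 x (1 : ℂ) : D.L2))

/-- `η` is the density of states of the self-adjoint random bounded operator `A` over `(Ω, μ)`: the
Radon measure on `ℝ` with
`∫ φ dη = ∫_Ω ∑ x ∈ D, ρ(x) ⟨δ_x, φ(A_D) δ_x⟩ dμ(D)` for all `φ ∈ C_c(ℝ)`,
whatever the non-negative function `ρ ∈ C_c(G)` of Haar integral one. -/
structure IsDensityOfStates [MeasurableSpace G] (m : Measure G) (Ω : Closeds (DeloneSet P))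
    (μ : Measure (DeloneSet P)) (A : BoundedFamily P) (η : Measure ℝ) : Prop where
  isLocallyFiniteMeasure : IsLocallyFiniteMeasure η
  integrable : ∀ ρ : C_c(G, ℝ), (∀ x, 0 ≤ ρ x) → ∫ x, ρ x ∂m = 1 → ∀ φ : C_c(ℝ, ℂ),
    IntegrableOn (localTrace A ρ φ) (Ω : Set (DeloneSet P)) μ
  integral_eq : ∀ ρ : C_c(G, ℝ), (∀ x, 0 ≤ ρ x) → ∫ x, ρ x ∂m = 1 → ∀ φ : C_c(ℝ, ℂ),
    ∫ t, φ t ∂η = ∫ D in (Ω : Set (DeloneSet P)), localTrace A ρ φ D ∂μ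

end Delone

end DeloneDOS

end

noncomputable section

namespace DeloneDOS

/-! ### The topology of the space of Delone sets -/

section Topology

variable {G : Type*} [Group G] [TopologicalSpace G] {P : DeloneParameters G}

/-! For every weight `ρ` and every `φ ∈ C_c(ℝ)` the integral of `φ` against the density of states is
the `μ`-mean of one and the same function on the space of Delone sets, `D ↦ ∑ x ∈ D, ρ(x) ⟨δ_x,
φ(A_D) δ_x⟩`. The theorem follows from two facts: this function is continuous, and the measures `μl`
converge weakly to `μ`.

Continuity. Matrix entries of kernels of finite type are continuous on triples `(x, D, y)`. Sums
over the points of `D` with locally compact support depend continuously on `D`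
(`continuous_tsum_pts`), so families of finite type form an algebra, and so do their uniform limits.
Since the spectra of all `A_D` lie in a common interval, Weierstrass approximation puts `φ(A)` into
the latter algebra (`IsApproximable.calculus`). A further sum over points gives
`continuous_weightedTrace`.

Weak convergence. The space of Delone sets is compact Hausdorff, so `μl` has a limit along every
ultrafilter. Limits are invariant probability measures; as `Ωl` eventually avoids each compact set
disjoint from `Ω`, they live on `Ω`. By unique ergodicity they all equal `μ`
(`IsUniquelyErgodic.tsendsto_integral` is replaced by its sequence form
`IsUniquelyErgodic.tendsto_integral`).

Existence comes from the Riesz representation theorem applied to `φ`, independence of `ρ` from the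
same theorem applied to `ρ`: the resulting measure on `G` is left invariant, hence a multiple of
Haar measure. -/

lemma DeloneSet.mem_coe {D : DeloneSet P} {x : G} : x ∈ (D.carrier : Set G) ↔ x ∈ D := Iff.rfl

lemma DeloneSet.isOpen_miss {C : Set G} (hC : IsCompact C) :
    IsOpen {D : DeloneSet P | ∀ x ∈ C, x ∉ D} := by
  refine ⟨{Y : Closeds G | C ∩ (Y : Set G) = ∅},
    isOpen_generateFrom_of_mem ⟨C, ∅, hC, Set.finite_empty, by simp, by simp⟩, ?_⟩
  ext D
  simp only [Set.mem_preimage, Set.mem_ofPred_eq, Set.eq_empty_iff_forall_notMem, Set.mem_inter_iff,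
    not_and, DeloneSet.mem_coe]

lemma DeloneSet.isOpen_hit {O : Set G} (hO : IsOpen O) :
    IsOpen {D : DeloneSet P | ∃ x ∈ O, x ∈ D} := by
  refine ⟨{Y : Closeds G | (O ∩ (Y : Set G)).Nonempty},
    isOpen_generateFrom_of_mem ⟨∅, {O}, isCompact_empty, Set.finite_singleton O, by simpa using hO,
      by simp⟩, ?_⟩
  ext D
  simp only [Set.mem_preimage, Set.mem_ofPred_eq, Set.Nonempty, Set.mem_inter_iff, DeloneSet.mem_coe]

/-- Convergence in the Chabauty–Fell topology, tested on compact sets that the limit misses and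
open sets that it hits. -/
lemma DeloneSet.tendsto_nhds_iff {ι : Type*} {f : ι → DeloneSet P} {l : Filter ι}
    {D : DeloneSet P} : Tendsto f l (𝓝 D) ↔
      (∀ C : Set G, IsCompact C → (∀ x ∈ C, x ∉ D) → ∀ᶠ i in l, ∀ x ∈ C, x ∉ f i) ∧
      ∀ O : Set G, IsOpen O → (∃ x ∈ O, x ∈ D) → ∀ᶠ i in l, ∃ x ∈ O, x ∈ f i := by
  refine ⟨fun h => ⟨fun C hC hD => h ((DeloneSet.isOpen_miss hC).mem_nhds hD),
    fun O hO hD => h ((DeloneSet.isOpen_hit hO).mem_nhds hD)⟩, fun ⟨h1, h2⟩ => ?_⟩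
  let _ := chabautyFell G
  rw [nhds_induced, tendsto_comap_iff, tendsto_nhds_generateFrom_iff]
  rintro _ ⟨C, 𝒪, hC, hfin, hop, rfl⟩ ⟨hDC, hDO⟩
  have hmiss := h1 C hC fun x hx hxD => (Set.eq_empty_iff_forall_notMem.1 hDC x) ⟨hx, hxD⟩
  have hhit : ∀ᶠ i in l, ∀ O ∈ 𝒪, ∃ x ∈ O, x ∈ f i :=
    (eventually_all_finite hfin).2 fun O hO => h2 O (hop O hO) (hDO O hO)
  filter_upwards [hmiss, hhit] with i hi1 hi2
  exact ⟨Set.eq_empty_iff_forall_notMem.2 fun x hx => hi1 x hx.1 hx.2, hi2⟩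

variable [IsTopologicalGroup G]

lemma DeloneSet.mem_smul_iff {g x : G} {D : DeloneSet P} : x ∈ g • D ↔ g⁻¹ * x ∈ D :=
  Set.mem_smul_set_iff_inv_smul_mem (A := (D.carrier : Set G))

lemma DeloneSet.continuous_smul (g : G) : Continuous fun D : DeloneSet P => g • D := by
  rw [continuous_iff_continuousAt]
  refine fun D => DeloneSet.tendsto_nhds_iff.2 ⟨fun C hC hD => ?_, fun O hO hD => ?_⟩
  · filter_upwards [(DeloneSet.isOpen_miss (P := P) (hC.smul g⁻¹)).mem_nhds (x := D) (by
      rintro _ ⟨x, hx, rfl⟩ h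
      exact hD x hx (DeloneSet.mem_smul_iff.2 h))] with D' hD' x hx h
    exact hD' _ ⟨x, hx, rfl⟩ (DeloneSet.mem_smul_iff.1 h)
  · obtain ⟨x, hx, hxD⟩ := hD
    filter_upwards [(DeloneSet.isOpen_hit (P := P) (hO.smul g⁻¹)).mem_nhds (x := D)
      ⟨_, ⟨x, hx, rfl⟩, DeloneSet.mem_smul_iff.1 hxD⟩] with D' hD'
    obtain ⟨_, ⟨y, hy, rfl⟩, hyD⟩ := hD'
    exact ⟨y, hy, DeloneSet.mem_smul_iff.2 hyD⟩

/-- Translation by `g` as a homeomorphism of the space of Delone sets. -/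
def DeloneSet.smulHomeomorph (g : G) : DeloneSet P ≃ₜ DeloneSet P where
  toFun D := g • D
  invFun D := g⁻¹ • D
  left_inv D := inv_smul_smul g D
  right_inv D := smul_inv_smul g D
  continuous_toFun := DeloneSet.continuous_smul g
  continuous_invFun := DeloneSet.continuous_smul g⁻¹

variable [LocallyCompactSpace G] [T2Space G]

/-- Distinct Delone sets differ in some point `z`, which has a compact neighbourhood missing the set
that does not contain `z`. Hitting the interior of this neighbourhood and missing all of it are
disjoint open conditions. -/
instance : T2Space (DeloneSet P) := by
  have key : ∀ (D D' : DeloneSet P) (z : G), z ∈ D → z ∉ D' →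
      ∃ u v : Set (DeloneSet P), IsOpen u ∧ IsOpen v ∧ D ∈ u ∧ D' ∈ v ∧ Disjoint u v := by
    intro D D' z hz hz'
    obtain ⟨N, hN, hzN, hND⟩ := exists_compact_subset D'.carrier.isClosed.isOpen_compl hz'
    refine ⟨_, _, DeloneSet.isOpen_hit isOpen_interior, DeloneSet.isOpen_miss hN,
      ⟨z, hzN, hz⟩, fun x hx => hND hx, ?_⟩
    rw [Set.disjoint_left]
    rintro E ⟨x, hx, hxE⟩ hE
    exact hE x (interior_subset hx) hxE
  refine ⟨fun D D' hne => ?_⟩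
  by_cases h : ∃ z, z ∈ D ∧ z ∉ D'
  · obtain ⟨z, hz, hz'⟩ := h
    exact key D D' z hz hz'
  · obtain ⟨z, hz, hz'⟩ : ∃ z, z ∈ D' ∧ z ∉ D := by
      by_contra h'
      push Not at h h'
      exact hne (DeloneSet.ext (SetLike.ext fun z => ⟨h z, h' z⟩))
    obtain ⟨u, v, hu, hv, h1, h2, h3⟩ := key D' D z hz hz'
    exact ⟨v, u, hv, hu, h2, h1, h3.symm⟩

/-- An ultrafilter converges to the set `Y` of points all of whose neighbourhoods are hit by almost
every `D`. Both Delone conditions pass to `Y`, because a failure would already be visible in a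
single `D`. -/
instance : CompactSpace (DeloneSet P) := by
  refine ⟨isCompact_iff_ultrafilter_le_nhds'.2 fun 𝒰 _ => ?_⟩
  let Y : Set G := {z | ∀ O : Set G, IsOpen O → z ∈ O → ∀ᶠ D : DeloneSet P in 𝒰, ∃ x ∈ O, x ∈ D}
  have hmiss : ∀ C : Set G, IsCompact C → (∀ x ∈ C, x ∉ Y) →
      ∀ᶠ D : DeloneSet P in 𝒰, ∀ x ∈ C, x ∉ D := by
    intro C hC hCY
    have hex : ∀ z ∈ C, ∃ O : Set G, IsOpen O ∧ z ∈ O ∧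
        ∀ᶠ D : DeloneSet P in 𝒰, ∀ x ∈ O, x ∉ D := by
      intro z hz
      have h := hCY z hz
      simp only [Y, Set.mem_ofPred_eq, not_forall] at h
      obtain ⟨O, hO, hzO, h⟩ := h
      refine ⟨O, hO, hzO, (Ultrafilter.eventually_not.2 h).mono fun D hD x hx hxD =>
        hD ⟨x, hx, hxD⟩⟩
    choose! O hO hzO hev using hex
    obtain ⟨b, hbC, hb, hcov⟩ := hC.elim_finite_subcover_image (b := C) (c := O) hO
      (fun z hz => Set.mem_biUnion hz (hzO z hz))
    filter_upwards [(eventually_all_finite hb).2 fun z hz => hev z (hbC hz)] with D hD x hx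
    obtain ⟨z, hz, hxz⟩ := Set.mem_iUnion₂.1 (hcov hx)
    exact hD z hz x hxz
  have hYclosed : IsClosed Y := by
    rw [← isOpen_compl_iff, isOpen_iff_mem_nhds]
    intro z hz
    simp only [Y, Set.mem_compl_iff, Set.mem_ofPred_eq, not_forall] at hz
    obtain ⟨O, hO, hzO, h⟩ := hz
    filter_upwards [hO.mem_nhds hzO] with w hw hwY
    exact h (hwY O hO hw)
  -- If `g ∉ Y * K`, then `Y` misses the compact set `gK⁻¹`, hence so does some Delone set `D`,
  -- contradicting `g ∈ D * K`.
  have hdense : Y * P.K = Set.univ := by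
    refine Set.eq_univ_of_forall fun g => ?_
    by_contra hg
    have hC : IsCompact (g • P.K⁻¹) := P.isCompact_K.inv.smul g
    obtain ⟨D, hD⟩ := (hmiss _ hC (by
      rintro _ ⟨k, hk, rfl⟩ hY
      exact hg ⟨g • k, hY, k⁻¹, hk, by simp⟩)).exists
    have hgD : g ∈ (D.carrier : Set G) * P.K := by
      rw [D.isDelone.relativelyDense]; trivial
    obtain ⟨d, hd, k, hk, rfl⟩ := hgD
    exact hD d ⟨k⁻¹, by simpa using hk, by simp⟩ hd
  have hY : IsDelone P Y := by
    refine ⟨?_, fun g => ?_, hdense⟩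
    · have h1 : (1 : G) ∈ Y * P.K := by rw [hdense]; trivial
      obtain ⟨y, hy, -⟩ := h1
      exact ⟨y, hy⟩
    -- Two distinct points of `Y` in `gU` have disjoint neighbourhoods inside `gU`, and a common `D`
    -- would hit both.
    · rintro x ⟨hxU, hxY⟩ y ⟨hyU, hyY⟩
      by_contra hne
      obtain ⟨V, W, hV, hW, hxV, hyW, hVW⟩ := t2_separation hne
      have hg := P.isOpen_U.smul g
      obtain ⟨D, ⟨x', hx', hx'D⟩, ⟨y', hy', hy'D⟩⟩ :=
        ((hxY (V ∩ g • P.U) (hV.inter hg) ⟨hxV, hxU⟩).and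
          (hyY (W ∩ g • P.U) (hW.inter hg) ⟨hyW, hyU⟩)).exists
      have := D.isDelone.uniformlyDiscrete g ⟨hx'.2, hx'D⟩ ⟨hy'.2, hy'D⟩
      exact Set.disjoint_left.1 hVW hx'.1 (this ▸ hy'.1)
  refine ⟨⟨⟨Y, hYclosed⟩, hY⟩, trivial, ?_⟩
  change Tendsto id _ _
  exact DeloneSet.tendsto_nhds_iff.2 ⟨hmiss, fun O hO ⟨x, hx, hxY⟩ => hxY O hO hx⟩

end Topology

/-! ### Continuity of sums over the points of a Delone set -/

section Sums

variable {G : Type*} [Group G] [TopologicalSpace G] [IsTopologicalGroup G] {P : DeloneParameters G}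

/-- A neighbourhood of `z` containing at most one point of every Delone set. -/
lemma exists_isOpen_subsingleton (P : DeloneParameters G) (z : G) :
    ∃ W : Set G, IsOpen W ∧ z ∈ W ∧
      ∀ (D : DeloneSet P) (x y : G), x ∈ W → y ∈ W → x ∈ D → y ∈ D → x = y := by
  obtain ⟨u, hu⟩ := P.nonempty_U
  exact ⟨(z * u⁻¹) • P.U, P.isOpen_U.smul _, ⟨u, hu, by simp⟩,
    fun D x y hx hy hxD hyD => D.isDelone.uniformlyDiscrete _ ⟨hx, hxD⟩ ⟨hy, hyD⟩⟩

/-- `exists_card_le` counts points relative to a base point `x ∈ D`, hence the translate `x⁻¹C`. -/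
lemma DeloneSet.finite_inter (D : DeloneSet P) {C : Set G} (hC : IsCompact C) :
    {z : G | z ∈ D ∧ z ∈ C}.Finite := by
  obtain ⟨x, hx⟩ := D.isDelone.nonempty
  obtain ⟨N, hN⟩ := exists_card_le P (hC.smul x⁻¹)
  obtain ⟨F, hF, -⟩ := hN D ⟨x, hx⟩
  refine (F.finite_toSet.image Subtype.val).subset fun z hz => ⟨⟨z, hz.1⟩, ?_, rfl⟩
  exact Finset.mem_coe.2 ((hF _).2 ⟨z, hz.2, by simp⟩)

/-- If `F(t, z)` is continuous in `t` and `z ∈ D(t)` and vanishes for `z` outside of a compact set,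
locally uniformly in `t`, then `∑ z ∈ D(t), F(t, z)` is continuous in `t`. -/
lemma continuous_tsum_pts [T2Space G] {T : Type*} [TopologicalSpace T] {D : T → DeloneSet P}
    (hD : Continuous D) (F : {p : T × G // p.2 ∈ D p.1} → ℂ) (hF : Continuous F)
    (hsupp : ∀ t₀, ∃ C : Set G, IsCompact C ∧
      ∀ᶠ t in 𝓝 t₀, ∀ (z : G) (hz : z ∈ D t), z ∉ C → F ⟨(t, z), hz⟩ = 0) :
    Continuous fun t => ∑' z : (D t).Pts, F ⟨(t, z.1), z.2⟩ := by
  classical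
  -- Extension by zero removes the membership proofs, so that `F` can be evaluated along moving
  -- points.
  let F' : T × G → ℂ := fun p => if h : p.2 ∈ D p.1 then F ⟨p, h⟩ else 0
  have hF'eq : ∀ t z (h : z ∈ D t), F' (t, z) = F ⟨(t, z), h⟩ := fun t z h => dif_pos h
  have hF' : ContinuousOn F' {p | p.2 ∈ D p.1} := by
    rw [continuousOn_iff_continuous_domRestrict]
    exact hF.congr fun p => (hF'eq p.1.1 p.1.2 p.2).symm
  rw [continuous_iff_continuousAt]
  intro t₀
  obtain ⟨C, hC, hsupp⟩ := hsupp t₀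
  have hfin := (D t₀).finite_inter hC
  obtain ⟨V, hV, hdisj⟩ := hfin.t2_separation
  choose W hWo hzW hWs using exists_isOpen_subsingleton P
  -- The sets `V z` separate the finitely many points of `D t₀` in `C`; `W z` contains at most one
  -- point of any Delone set.
  let N : G → Set G := fun z => V z ∩ W z
  have hNo : ∀ z, IsOpen (N z) := fun z => (hV z).2.inter (hWo z)
  have hzN : ∀ z, z ∈ N z := fun z => ⟨(hV z).1, hzW z⟩
  -- `ζ z t` follows the point `z` of `D t₀` as `t` varies: it is the only point of `D t` in `N z`.
  -- The default value `z` plays no role near `t₀`.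
  let ζ : G → T → G := fun z t => if h : ∃ x ∈ N z, x ∈ D t then h.choose else z
  have hζ : ∀ z t, (∃ x ∈ N z, x ∈ D t) → ζ z t ∈ N z ∧ ζ z t ∈ D t := by
    intro z t h
    have : ζ z t = h.choose := dif_pos h
    rw [this]
    exact h.choose_spec
  have hhit : ∀ z, z ∈ D t₀ → ∀ O : Set G, IsOpen O → z ∈ O → ∀ᶠ t in 𝓝 t₀, ∃ x ∈ O, x ∈ D t :=
    fun z hz O hO hzO => hD.continuousAt.eventually ((DeloneSet.isOpen_hit hO).mem_nhds
      (show D t₀ ∈ {D : DeloneSet P | ∃ x ∈ O, x ∈ D} from ⟨z, hzO, hz⟩))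
  have hζlim : ∀ z, z ∈ D t₀ → Tendsto (ζ z) (𝓝 t₀) (𝓝 z) := by
    intro z hz
    rw [tendsto_nhds]
    intro O hO hzO
    filter_upwards [hhit z hz (O ∩ N z) (hO.inter (hNo z)) ⟨hzO, hzN z⟩] with t ht
    obtain ⟨x, ⟨hxO, hxN⟩, hxD⟩ := ht
    obtain ⟨h1, h2⟩ := hζ z t ⟨x, hxN, hxD⟩
    rw [Set.mem_preimage, hWs z (D t) _ _ h1.2 hxN.2 h2 hxD]
    exact hxO
  have hζ₀ : ∀ z, z ∈ D t₀ → ζ z t₀ = z := fun z hz => by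
    obtain ⟨h1, h2⟩ := hζ z t₀ ⟨z, hzN z, hz⟩
    exact hWs z (D t₀) _ _ h1.2 (hzN z).2 h2 hz
  let s := hfin.toFinset
  have hs : ∀ z, z ∈ s ↔ z ∈ D t₀ ∧ z ∈ C := fun z => by simp [s]
  -- `D t₀` misses this compact remainder, so `D t` does too for `t` near `t₀`: every point of `D t`
  -- in `C` is then some `ζ z t`.
  have hC' : IsCompact (C \ ⋃ z ∈ s, N z) := hC.diff (isOpen_biUnion fun z _ => hNo z)
  have hmiss : ∀ᶠ t in 𝓝 t₀, ∀ x ∈ C \ ⋃ z ∈ s, N z, x ∉ D t :=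
    hD.continuousAt.eventually ((DeloneSet.isOpen_miss hC').mem_nhds
      (show D t₀ ∈ {D : DeloneSet P | ∀ x ∈ C \ ⋃ z ∈ s, N z, x ∉ D} from
        fun x hx hxD => hx.2 (Set.mem_biUnion ((hs x).2 ⟨hxD, hx.1⟩) (hzN x))))
  have hhits : ∀ᶠ t in 𝓝 t₀, ∀ z ∈ s, ∃ x ∈ N z, x ∈ D t :=
    (eventually_all_finset s).2 fun z hz => hhit z ((hs z).1 hz).1 _ (hNo z) (hzN z)
  have hsum : ∀ᶠ t in 𝓝 t₀,
      ∑' z : (D t).Pts, F ⟨(t, z.1), z.2⟩ = ∑ z ∈ s, F' (t, ζ z t) := by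
    filter_upwards [hmiss, hhits, hsupp] with t hm hh hsp
    let j : s → (D t).Pts := fun z => ⟨ζ z t, (hζ z t (hh z z.2)).2⟩
    have hj : Function.Injective j := by
      intro z w hzw
      have hzw' : ζ z t = ζ w t := congrArg Subtype.val hzw
      by_contra hne
      have hd := hdisj (by simpa using (hs z).1 z.2) (by simpa using (hs w).1 w.2)
        (fun h => hne (Subtype.ext h))
      refine Set.disjoint_left.1 hd (hζ z t (hh z z.2)).1.1 ?_
      rw [hzw']
      exact (hζ w t (hh w w.2)).1.1
    rw [← hj.tsum_eq, tsum_fintype, ← Finset.sum_coe_sort s]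
    · exact Finset.sum_congr rfl fun z _ => (hF'eq _ _ _).symm
    · intro x hx
      have hxC : x.1 ∈ C := by
        by_contra h
        exact hx (hsp x.1 x.2 h)
      have hxN : x.1 ∈ ⋃ z ∈ s, N z := by
        by_contra h
        exact hm x.1 ⟨hxC, h⟩ x.2
      obtain ⟨z, hz, hxz⟩ := Set.mem_iUnion₂.1 hxN
      refine ⟨⟨z, hz⟩, Subtype.ext ?_⟩
      obtain ⟨h1, h2⟩ := hζ z t (hh z hz)
      exact hWs z (D t) _ _ h1.2 hxz.2 h2 x.2
  refine Tendsto.congr' (EventuallyEq.symm hsum) ?_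
  simp only [hsum.self_of_nhds]
  refine tendsto_finsetSum _ fun z hz => ?_
  have hz' := ((hs z).1 hz).1
  rw [hζ₀ z hz']
  refine (hF' (t₀, z) hz').tendsto.comp (tendsto_nhdsWithin_iff.2
    ⟨tendsto_id.prodMk_nhds (hζlim z hz'), ?_⟩)
  filter_upwards [hhits] with t ht
  exact (hζ z t (ht z hz)).2

end Sums

/-! ### Matrix entries of families of operators -/

section Entries

variable {G : Type*} [Group G] [TopologicalSpace G] {P : DeloneParameters G}

variable (P) in
/-- Families of bounded operators on the Hilbert spaces `ℓ²(D)`, as an algebra. -/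
abbrev OperatorFamily : Type _ := ∀ D : DeloneSet P, D.L2 →L[ℂ] D.L2

open Classical in
/-- The standard basis vector `δ_x` of `ℓ²(D)`. -/
def DeloneSet.basisVec (D : DeloneSet P) (x : D.Pts) : D.L2 := lp.single 2 x (1 : ℂ)

lemma DeloneSet.norm_basisVec (D : DeloneSet P) (x : D.Pts) : ‖D.basisVec x‖ = 1 := by
  classical
  rw [DeloneSet.basisVec, lp.norm_single (by norm_num), norm_one]

/-- Ensures that the identity operator has norm one, for bounding the spectrum by the norm. -/
lemma DeloneSet.nontrivial_L2 (D : DeloneSet P) : Nontrivial D.L2 := by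
  obtain ⟨x, hx⟩ := D.isDelone.nonempty
  refine nontrivial_of_ne (D.basisVec ⟨x, hx⟩) 0 fun h => ?_
  simpa [h] using D.norm_basisVec ⟨x, hx⟩

lemma DeloneSet.inner_basisVec_left (D : DeloneSet P) (x : D.Pts) (u : D.L2) :
    inner ℂ (D.basisVec x) u = u x := by
  classical
  rw [DeloneSet.basisVec, lp.inner_single_left]
  simp

/-- The matrix entry `⟨δ_x, B_D δ_y⟩` at the point `(x, D, y)`. -/
def entry (B : OperatorFamily P) (p : KernelDomain P) : ℂ :=
  B p.1.2.1 (p.1.2.1.basisVec ⟨p.1.2.2, p.2.2⟩) ⟨p.1.1, p.2.1⟩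

lemma entry_add (B C : OperatorFamily P) : entry (B + C) = entry B + entry C := rfl

lemma entry_smul (c : ℂ) (B : OperatorFamily P) : entry (c • B) = c • entry B := rfl

lemma norm_entry_le (B : OperatorFamily P) (p : KernelDomain P) : ‖entry B p‖ ≤ ‖B p.1.2.1‖ :=
  calc ‖entry B p‖ ≤ ‖B p.1.2.1 (p.1.2.1.basisVec ⟨p.1.2.2, p.2.2⟩)‖ :=
        lp.norm_apply_le_norm (by norm_num) _ _
    _ ≤ ‖B p.1.2.1‖ * ‖p.1.2.1.basisVec ⟨p.1.2.2, p.2.2⟩‖ := ContinuousLinearMap.le_opNorm _ _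
    _ = ‖B p.1.2.1‖ := by rw [DeloneSet.norm_basisVec, mul_one]

lemma dist_entry_le (B C : OperatorFamily P) (p : KernelDomain P) :
    dist (entry B p) (entry C p) ≤ ‖B p.1.2.1 - C p.1.2.1‖ := by
  rw [dist_eq_norm]
  exact norm_entry_le (B - C) p

/-- Writing `(B u)(x) = ⟨B* δ_x, u⟩` turns the value into an inner product in `ℓ²(D)`, which is a
sum by definition; no expansion of `u` in basis vectors is needed. -/
lemma apply_eq_tsum_entry (B : OperatorFamily P) {x : G} {D : DeloneSet P} (hx : x ∈ D)
    (u : D.L2) : B D u ⟨x, hx⟩ = ∑' z : D.Pts, entry B ⟨(x, D, z.1), hx, z.2⟩ * u z := by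
  rw [← DeloneSet.inner_basisVec_left, ← ContinuousLinearMap.adjoint_inner_left,
    lp.inner_eq_tsum]
  refine tsum_congr fun z => ?_
  have h : entry B ⟨(x, D, z.1), hx, z.2⟩ =
      starRingEnd ℂ ((ContinuousLinearMap.adjoint (B D) (D.basisVec ⟨x, hx⟩)) z) := by
    rw [← DeloneSet.inner_basisVec_left, inner_conj_symm, ContinuousLinearMap.adjoint_inner_left,
      DeloneSet.inner_basisVec_left]
    rfl
  rw [h, RCLike.inner_apply, mul_comm]

lemma entry_mul (B C : OperatorFamily P) {x y : G} {D : DeloneSet P} (hx : x ∈ D) (hy : y ∈ D) :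
    entry (B * C) ⟨(x, D, y), hx, hy⟩ = ∑' z : D.Pts,
      entry B ⟨(x, D, z.1), hx, z.2⟩ * entry C ⟨(z.1, D, y), z.2, hy⟩ :=
  apply_eq_tsum_entry B hx _

open Classical in
lemma entry_one (p : KernelDomain P) :
    entry (1 : OperatorFamily P) p = if p.1.1 = p.1.2.2 then 1 else 0 := by
  change (lp.single 2 (⟨p.1.2.2, p.2.2⟩ : p.1.2.1.Pts) (1 : ℂ) : p.1.2.1.L2) ⟨p.1.1, p.2.1⟩ = _
  rw [lp.single_apply, Pi.single_apply]
  simp only [Subtype.mk.injEq]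

lemma entry_op [IsTopologicalGroup G] (a : FiniteTypeKernel P) :
    entry (fun D => a.op D) = a.toFun := by
  classical
  ext ⟨⟨x, D, y⟩, hx, hy⟩
  change a.op D (D.basisVec ⟨y, hy⟩) ⟨x, hx⟩ = _
  rw [FiniteTypeKernel.op_apply, tsum_eq_single ⟨y, hy⟩]
  · rw [DeloneSet.basisVec, lp.single_apply_self, mul_one]
    rfl
  · intro z hz
    rw [DeloneSet.basisVec, lp.single_apply_ne _ _ _ hz, mul_zero]

end Entries

/-! ### The functional calculus -/

section Calculus

variable {G : Type*} [Group G] [TopologicalSpace G] {P : DeloneParameters G}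

/-- A complex polynomial approximating a continuous function on a compact interval. -/
lemma exists_complex_polynomial_near {f : ℝ → ℂ} (hf : Continuous f) (R : ℝ) {ε : ℝ}
    (hε : 0 < ε) :
    ∃ q : Polynomial ℂ, ∀ t ∈ Set.Icc (-R) R, ‖f t - q.eval (t : ℂ)‖ ≤ ε := by
  obtain ⟨q₁, h₁⟩ := exists_polynomial_near_of_continuousOn (-R) R (fun t => (f t).re)
    (by fun_prop) (ε / 2) (half_pos hε)
  obtain ⟨q₂, h₂⟩ := exists_polynomial_near_of_continuousOn (-R) R (fun t => (f t).im)
    (by fun_prop) (ε / 2) (half_pos hε)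
  refine ⟨q₁.map (algebraMap ℝ ℂ) + Polynomial.C Complex.I * q₂.map (algebraMap ℝ ℂ),
    fun t ht => ?_⟩
  have hev : ∀ q : Polynomial ℝ, (q.map (algebraMap ℝ ℂ)).eval (t : ℂ) = ((q.eval t : ℝ) : ℂ) :=
    fun q => Polynomial.eval_map_algebraMap q (t : ℂ) |>.trans
      (Polynomial.aeval_algebraMap_apply_eq_algebraMap_eval t q)
  rw [Polynomial.eval_add, Polynomial.eval_mul, Polynomial.eval_C, hev, hev]
  have : f t - (((q₁.eval t : ℝ) : ℂ) + Complex.I * ((q₂.eval t : ℝ) : ℂ)) =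
      (((f t).re - q₁.eval t : ℝ) : ℂ) + Complex.I * (((f t).im - q₂.eval t : ℝ) : ℂ) := by
    conv_lhs => rw [← Complex.re_add_im (f t)]
    push_cast
    ring
  rw [this]
  refine (norm_add_le _ _).trans ?_
  rw [norm_mul, Complex.norm_I, one_mul, Complex.norm_real, Complex.norm_real, Real.norm_eq_abs,
    Real.norm_eq_abs, abs_sub_comm, abs_sub_comm (f t).im]
  linarith [h₁ t ht, h₂ t ht]

/-- The continuous functional calculus of a self-adjoint family, as in `localTrace`. -/
def calculus (A : OperatorFamily P) (f : ℝ → ℂ) : OperatorFamily P :=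
  fun D => cfc (fun z : ℂ => f z.re) (A D)

lemma calculus_add (A : OperatorFamily P) (hsa : ∀ D, IsSelfAdjoint (A D)) {f g : ℝ → ℂ}
    (hf : Continuous f) (hg : Continuous g) :
    calculus A (fun t => f t + g t) = calculus A f + calculus A g := by
  funext D
  have hn : IsStarNormal (A D) := (hsa D).isStarNormal
  exact cfc_add (A D) (fun z : ℂ => f z.re) (fun z : ℂ => g z.re) (by fun_prop) (by fun_prop)

lemma calculus_smul (A : OperatorFamily P) (c : ℂ) {f : ℝ → ℂ} (hf : Continuous f) :
    calculus A (fun t => c * f t) = c • calculus A f := by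
  funext D
  exact cfc_const_mul c (fun z : ℂ => f z.re) (A D) (by fun_prop)

/-- The diagonal entries of `f(A)` are non-negative for `f ≥ 0`. -/
lemma entry_calculus_nonneg (A : OperatorFamily P) (hsa : ∀ D, IsSelfAdjoint (A D)) {f : ℝ → ℝ}
    (hf : Continuous f) (hf0 : ∀ t, 0 ≤ f t) {x : G} {D : DeloneSet P} (hx : x ∈ D) :
    ∃ r : ℝ, 0 ≤ r ∧ entry (calculus A fun t => (f t : ℂ)) ⟨(x, D, x), hx, hx⟩ = r := by
  have hn : IsStarNormal (A D) := (hsa D).isStarNormal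
  -- With `s = √f`, `f(A) = s(A)* s(A)`, so the diagonal entry at `x` is `‖s(A) δ_x‖²`.
  let s : ℂ → ℂ := fun z => (Real.sqrt (f z.re) : ℂ)
  have hs : Continuous s := by fun_prop
  have hss : calculus A (fun t => (f t : ℂ)) D = star (cfc s (A D)) * cfc s (A D) := by
    rw [← cfc_star, ← cfc_mul (fun z => star (s z)) s (A D) (by fun_prop) (by fun_prop)]
    refine cfc_congr fun z _ => ?_
    simp only [s, Complex.star_def, Complex.conj_ofReal, ← Complex.ofReal_mul]
    rw [Real.mul_self_sqrt (hf0 _)]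
  refine ⟨‖cfc s (A D) (D.basisVec ⟨x, hx⟩)‖ ^ 2, by positivity, ?_⟩
  change calculus A (fun t => (f t : ℂ)) D (D.basisVec ⟨x, hx⟩) ⟨x, hx⟩ = _
  rw [← DeloneSet.inner_basisVec_left, hss, mul_apply_eq_comp,
    ContinuousLinearMap.star_eq_adjoint, ContinuousLinearMap.adjoint_inner_right,
    inner_self_eq_norm_sq_to_K]
  norm_cast

/-- Split `f` into its positive and negative parts. -/
lemma entry_calculus_real (A : OperatorFamily P) (hsa : ∀ D, IsSelfAdjoint (A D)) {f : ℝ → ℝ}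
    (hf : Continuous f) {x : G} {D : DeloneSet P} (hx : x ∈ D) :
    ∃ r : ℝ, entry (calculus A fun t => (f t : ℂ)) ⟨(x, D, x), hx, hx⟩ = r := by
  obtain ⟨r, -, hr⟩ := entry_calculus_nonneg A hsa (f := fun t => max (f t) 0) (by fun_prop)
    (fun t => le_max_right _ _) hx
  obtain ⟨s, -, hs⟩ := entry_calculus_nonneg A hsa (f := fun t => max (-f t) 0) (by fun_prop)
    (fun t => le_max_right _ _) hx
  refine ⟨r - s, ?_⟩
  have h : (fun t => (f t : ℂ)) =
      fun t => ((max (f t) 0 : ℝ) : ℂ) + (-1) * ((max (-f t) 0 : ℝ) : ℂ) := by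
    funext t
    rw [neg_one_mul, ← sub_eq_add_neg, ← Complex.ofReal_sub, max_zero_sub_eq_self]
  rw [h, calculus_add A hsa (by fun_prop) (by fun_prop), calculus_smul A (-1) (by fun_prop),
    entry_add, entry_smul, Pi.add_apply, Pi.smul_apply, hr, hs, smul_eq_mul, neg_one_mul,
    ← sub_eq_add_neg, Complex.ofReal_sub]

end Calculus

/-! ### The algebra of random bounded operators -/

section Algebra

variable {G : Type*} [Group G] [TopologicalSpace G] [IsTopologicalGroup G] {P : DeloneParameters G}

/-- Uniformly bounded families of operators with continuous and invariant matrix entries of finite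
range. -/
structure IsFiniteType (B : OperatorFamily P) : Prop where
  bounded : ∃ M : ℝ, ∀ D, ‖B D‖ ≤ M
  continuous_entry : Continuous (entry B)
  finiteRange : ∃ S : Set G, IsCompact S ∧
    ∀ p : KernelDomain P, p.1.1⁻¹ * p.1.2.2 ∉ S → entry B p = 0
  invariant : ∀ (g : G) (p : KernelDomain P), entry B (KernelDomain.translate g p) = entry B p

lemma FiniteTypeKernel.isFiniteType (a : FiniteTypeKernel P) :
    IsFiniteType (fun D => a.op D) where
  bounded := by
    obtain ⟨M, hM0, hM⟩ := a.exists_norm_linearMap_le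
    exact ⟨M, fun D => ContinuousLinearMap.opNorm_le_bound _ hM0 (hM D)⟩
  continuous_entry := by rw [entry_op]; exact a.continuous_toFun
  finiteRange := by
    obtain ⟨S, hS, -, h⟩ := a.finiteRange
    exact ⟨S, hS, by rwa [entry_op]⟩
  invariant := by rw [entry_op]; exact a.invariant

lemma IsFiniteType.add {B C : OperatorFamily P} (hB : IsFiniteType B) (hC : IsFiniteType C) :
    IsFiniteType (B + C) where
  bounded := by
    obtain ⟨M, hM⟩ := hB.bounded
    obtain ⟨N, hN⟩ := hC.bounded
    exact ⟨M + N, fun D => norm_add_le_of_le (hM D) (hN D)⟩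
  continuous_entry := hB.continuous_entry.add hC.continuous_entry
  finiteRange := by
    obtain ⟨S, hS, h⟩ := hB.finiteRange
    obtain ⟨S', hS', h'⟩ := hC.finiteRange
    refine ⟨S ∪ S', hS.union hS', fun p hp => ?_⟩
    rw [Set.mem_union, not_or] at hp
    rw [entry_add, Pi.add_apply, h p hp.1, h' p hp.2, add_zero]
  invariant g p := by
    rw [entry_add, Pi.add_apply, Pi.add_apply, hB.invariant, hC.invariant]

lemma IsFiniteType.smul (c : ℂ) {B : OperatorFamily P} (hB : IsFiniteType B) :
    IsFiniteType (c • B) where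
  bounded := by
    obtain ⟨M, hM⟩ := hB.bounded
    refine ⟨‖c‖ * M, fun D => ?_⟩
    rw [Pi.smul_apply, norm_smul]
    exact mul_le_mul_of_nonneg_left (hM D) (norm_nonneg c)
  continuous_entry := hB.continuous_entry.const_smul c
  finiteRange := by
    obtain ⟨S, hS, h⟩ := hB.finiteRange
    exact ⟨S, hS, fun p hp => by rw [entry_smul, Pi.smul_apply, h p hp, smul_zero]⟩
  invariant g p := by rw [entry_smul, Pi.smul_apply, Pi.smul_apply, hB.invariant]

/-- The indicator of `x = y` is locally constant: near a diagonal triple, uniform discreteness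
forces both points to coincide; off the diagonal, the Hausdorff property applies. -/
lemma continuous_entry_one [T2Space G] : Continuous (entry (1 : OperatorFamily P)) := by
  classical
  have hx : Continuous fun p : KernelDomain P => p.1.1 := by fun_prop
  have hy : Continuous fun p : KernelDomain P => p.1.2.2 := by fun_prop
  rw [continuous_iff_continuousAt]
  intro p
  refine continuousAt_const.congr (f := fun _ => entry (1 : OperatorFamily P) p) ?_
  by_cases h : p.1.1 = p.1.2.2
  · obtain ⟨W, hW, hpW, hWs⟩ := exists_isOpen_subsingleton P p.1.1
    filter_upwards [hx.continuousAt.eventually (hW.mem_nhds hpW),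
      hy.continuousAt.eventually (hW.mem_nhds (show p.1.2.2 ∈ W from h ▸ hpW))] with q hq1 hq2
    rw [entry_one, entry_one, if_pos h, if_pos (hWs _ _ _ hq1 hq2 q.2.1 q.2.2)]
  · filter_upwards [(isOpen_ne_fun hx hy).mem_nhds h] with q hq
    rw [entry_one, entry_one, if_neg h, if_neg hq]

lemma isFiniteType_one [T2Space G] : IsFiniteType (1 : OperatorFamily P) where
  bounded := ⟨1, fun D => ContinuousLinearMap.norm_id_le⟩
  continuous_entry := continuous_entry_one
  finiteRange := ⟨{1}, isCompact_singleton, fun p hp => by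
    classical
    rw [entry_one, if_neg fun h => hp (by simp [h])]⟩
  invariant g p := by
    classical
    simp only [entry_one, KernelDomain.translate, mul_right_inj]

/-- Translation by `g` as a bijection between the points of `D` and those of `gD`. -/
def DeloneSet.ptsEquiv (g : G) (D : DeloneSet P) : D.Pts ≃ (g • D).Pts where
  toFun z := ⟨g * z.1, DeloneSet.smul_mem_smul g z.2⟩
  invFun z := ⟨g⁻¹ * z.1, DeloneSet.mem_smul_iff.1 z.2⟩
  left_inv z := by simp
  right_inv z := by simp

/-- The entries of a product are sums over intermediate points `z ∈ D ∩ xS`. Continuity is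
`continuous_tsum_pts`, the range is contained in `S * S'`, and invariance follows by translating
`z`. -/
lemma IsFiniteType.mul [LocallyCompactSpace G] [T2Space G] {B C : OperatorFamily P}
    (hB : IsFiniteType B) (hC : IsFiniteType C) : IsFiniteType (B * C) where
  bounded := by
    obtain ⟨M, hM⟩ := hB.bounded
    obtain ⟨N, hN⟩ := hC.bounded
    exact ⟨M * N, fun D => (norm_mul_le _ _).trans
      (mul_le_mul (hM D) (hN D) (norm_nonneg _) ((norm_nonneg _).trans (hM D)))⟩
  continuous_entry := by
    obtain ⟨S, hS, h⟩ := hB.finiteRange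
    have hD : Continuous fun p : KernelDomain P => p.1.2.1 := by fun_prop
    have hx : Continuous fun p : KernelDomain P => p.1.1 := by fun_prop
    have key := continuous_tsum_pts hD
      (fun q => entry B ⟨(q.1.1.1.1, q.1.1.1.2.1, q.1.2), q.1.1.2.1, q.2⟩ *
        entry C ⟨(q.1.2, q.1.1.1.2.1, q.1.1.1.2.2), q.2, q.1.1.2.2⟩)
      (by
        refine (hB.continuous_entry.comp ?_).mul (hC.continuous_entry.comp ?_)
        · exact Continuous.subtype_mk (by fun_prop) _
        · exact Continuous.subtype_mk (by fun_prop) _)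
      (by
        intro p
        -- While `x` stays in the compact neighbourhood `V`, the contributing `z` stay in `V * S`.
        obtain ⟨V, hV, hpV⟩ := exists_compact_mem_nhds p.1.1
        refine ⟨V * S, hV.mul hS, ?_⟩
        filter_upwards [hx.continuousAt.eventually hpV] with q hq z hz hzC
        rw [h _ fun hmem => hzC ⟨_, hq, _, hmem, by simp⟩, zero_mul])
    exact key.congr fun p => (entry_mul B C p.2.1 p.2.2).symm
  finiteRange := by
    obtain ⟨S, hS, h⟩ := hB.finiteRange
    obtain ⟨S', hS', h'⟩ := hC.finiteRange
    refine ⟨S * S', hS.mul hS', fun ⟨⟨x, D, y⟩, hx, hy⟩ hp => ?_⟩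
    refine (entry_mul B C hx hy).trans ?_
    have hterm : ∀ z : D.Pts, entry B ⟨(x, D, z.1), hx, z.2⟩ *
        entry C ⟨(z.1, D, y), z.2, hy⟩ = 0 := by
      intro z
      by_cases hz : x⁻¹ * z.1 ∈ S
      · rw [h' ⟨(z.1, D, y), z.2, hy⟩ fun hz' => hp ⟨_, hz, _, hz', by simp [mul_assoc]⟩, mul_zero]
      · rw [h ⟨(x, D, z.1), hx, z.2⟩ hz, zero_mul]
    simp only [hterm, tsum_zero]
  invariant g p := by
    obtain ⟨⟨x, D, y⟩, hx, hy⟩ := p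
    have h := entry_mul B C (DeloneSet.smul_mem_smul g hx) (DeloneSet.smul_mem_smul g hy)
    refine h.trans ?_
    rw [entry_mul B C hx hy, ← (DeloneSet.ptsEquiv g D).tsum_eq]
    refine tsum_congr fun z => ?_
    exact congrArg₂ (· * ·) (hB.invariant g ⟨(x, D, z.1), hx, z.2⟩)
      (hC.invariant g ⟨(z.1, D, y), z.2, hy⟩)

variable (P) in
/-- The algebra of families of operators of finite type. -/
def finiteTypeAlgebra [LocallyCompactSpace G] [T2Space G] : Subalgebra ℂ (OperatorFamily P) where
  carrier := {B | IsFiniteType B}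
  mul_mem' := IsFiniteType.mul
  add_mem' := IsFiniteType.add
  algebraMap_mem' c := by
    rw [Algebra.algebraMap_eq_smul_one]
    exact isFiniteType_one.smul c

variable [LocallyCompactSpace G] [T2Space G]

/-- Uniform limits of families of finite type. -/
def IsApproximable (B : OperatorFamily P) : Prop :=
  ∀ ε > 0, ∃ C ∈ finiteTypeAlgebra P, ∀ D, ‖B D - C D‖ ≤ ε

lemma IsApproximable.bounded {B : OperatorFamily P} (hB : IsApproximable B) :
    ∃ M : ℝ, 0 ≤ M ∧ ∀ D, ‖B D‖ ≤ M := by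
  obtain ⟨C, hC, h⟩ := hB 1 one_pos
  obtain ⟨M, hM⟩ := IsFiniteType.bounded hC
  refine ⟨|1 + M|, abs_nonneg _, fun D => ?_⟩
  calc ‖B D‖ = ‖(B D - C D) + C D‖ := by rw [sub_add_cancel]
    _ ≤ 1 + M := norm_add_le_of_le (h D) (hM D)
    _ ≤ _ := le_abs_self _

variable (P) in
/-- The algebra of uniform limits of families of finite type. -/
def approximableAlgebra : Subalgebra ℂ (OperatorFamily P) where
  carrier := {B | IsApproximable B}
  add_mem' := by
    intro B B' hB hB' ε hε
    obtain ⟨C, hC, h⟩ := hB (ε / 2) (half_pos hε)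
    obtain ⟨C', hC', h'⟩ := hB' (ε / 2) (half_pos hε)
    refine ⟨C + C', add_mem hC hC', fun D => ?_⟩
    rw [Pi.add_apply, Pi.add_apply, add_sub_add_comm]
    exact (norm_add_le_of_le (h D) (h' D)).trans (add_halves ε).le
  mul_mem' := by
    intro B B' hB hB' ε hε
    obtain ⟨M, hM0, hM⟩ := hB.bounded
    -- `BB' - CC' = B(B' - C') + (B - C)C'`. The precision for `C` depends on a bound for `C'`,
    -- which is therefore chosen first; adding 1 avoids division by zero.
    obtain ⟨C', hC', h'⟩ := hB' (ε / 2 / (M + 1)) (by positivity)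
    obtain ⟨N, hN⟩ := IsFiniteType.bounded hC'
    obtain ⟨C, hC, h⟩ := hB (ε / 2 / (|N| + 1)) (by positivity)
    refine ⟨C * C', mul_mem hC hC', fun D => ?_⟩
    have h1 : ‖B D * (B' D - C' D)‖ ≤ ε / 2 :=
      calc ‖B D * (B' D - C' D)‖ ≤ ‖B D‖ * ‖B' D - C' D‖ := norm_mul_le _ _
        _ ≤ (M + 1) * (ε / 2 / (M + 1)) := by
          gcongr
          · exact (hM D).trans (by linarith)
          · exact h' D
        _ = ε / 2 := by field_simp
    have h2 : ‖(B D - C D) * C' D‖ ≤ ε / 2 :=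
      calc ‖(B D - C D) * C' D‖ ≤ ‖B D - C D‖ * ‖C' D‖ := norm_mul_le _ _
        _ ≤ (ε / 2 / (|N| + 1)) * (|N| + 1) := by
          gcongr
          · exact h D
          · exact (hN D).trans (by linarith [le_abs_self N])
        _ = ε / 2 := by field_simp
    calc ‖(B * B') D - (C * C') D‖ = ‖B D * (B' D - C' D) + (B D - C D) * C' D‖ := by
          congr 1
          rw [Pi.mul_apply, Pi.mul_apply, mul_sub, sub_mul, sub_add_sub_cancel]
      _ ≤ ε / 2 + ε / 2 := norm_add_le_of_le h1 h2
      _ = ε := add_halves ε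
  algebraMap_mem' c ε hε := ⟨_, algebraMap_mem _ c, fun D => by simpa using hε.le⟩

lemma isApproximable_of_mem_randomBoundedOperators {A : BoundedFamily P}
    (hA : A ∈ randomBoundedOperators P) : IsApproximable (fun D => A D) := by
  intro ε hε
  obtain ⟨_, ⟨a, rfl⟩, h⟩ := Metric.mem_closure_iff.1 hA ε hε
  refine ⟨fun D => a.op D, a.isFiniteType, fun D => ?_⟩
  rw [dist_eq_norm] at h
  exact (lp.norm_apply_le_norm (by simp) (A - a.family) D).trans h.le

lemma isApproximable_of_forall {B : OperatorFamily P}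
    (h : ∀ ε > 0, ∃ C, IsApproximable C ∧ ∀ D, ‖B D - C D‖ ≤ ε) : IsApproximable B := by
  intro ε hε
  obtain ⟨C, hC, h1⟩ := h (ε / 2) (half_pos hε)
  obtain ⟨C', hC', h2⟩ := hC (ε / 2) (half_pos hε)
  refine ⟨C', hC', fun D => ?_⟩
  rw [← sub_add_sub_cancel (B D) (C D) (C' D)]
  exact (norm_add_le_of_le (h1 D) (h2 D)).trans (add_halves ε).le

lemma IsApproximable.continuous_entry {B : OperatorFamily P} (hB : IsApproximable B) :
    Continuous (entry B) := by
  refine continuous_of_uniform_approx_of_continuous fun u hu => ?_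
  obtain ⟨ε, hε, hεu⟩ := Metric.mem_uniformity_dist.1 hu
  obtain ⟨C, hC, h⟩ := hB (ε / 2) (half_pos hε)
  refine ⟨entry C, IsFiniteType.continuous_entry hC, fun p => ?_⟩
  have hp : dist (entry B p) (entry C p) < ε :=
    ((dist_entry_le B C p).trans (h p.1.2.1)).trans_lt (half_lt_self hε)
  exact hεu hp

lemma IsApproximable.invariant {B : OperatorFamily P} (hB : IsApproximable B) (g : G)
    (p : KernelDomain P) : entry B (KernelDomain.translate g p) = entry B p := by
  refine eq_of_forall_dist_le fun ε hε => ?_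
  obtain ⟨C, hC, h⟩ := hB (ε / 2) (half_pos hε)
  have key : ∀ q, dist (entry B q) (entry C q) ≤ ε / 2 := fun q =>
    (dist_entry_le B C q).trans (h q.1.2.1)
  calc dist (entry B (KernelDomain.translate g p)) (entry B p)
      ≤ dist (entry B (KernelDomain.translate g p)) (entry C p) + dist (entry C p) (entry B p) :=
        dist_triangle _ _ _
    _ ≤ ε / 2 + ε / 2 := by
        refine add_le_add ?_ ?_
        · rw [← IsFiniteType.invariant hC g p]
          exact key _
        · rw [dist_comm]
          exact key p
    _ = ε := add_halves ε

lemma IsApproximable.aeval {A : OperatorFamily P} (hA : IsApproximable A) (q : Polynomial ℂ) :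
    IsApproximable fun D => Polynomial.aeval (A D) q := by
  induction q using Polynomial.induction_on' with
  | add q r hq hr =>
    simp only [map_add]
    exact (approximableAlgebra P).add_mem hq hr
  | monomial n c =>
    simp only [Polynomial.aeval_monomial]
    exact (approximableAlgebra P).mul_mem ((approximableAlgebra P).algebraMap_mem c)
      ((approximableAlgebra P).pow_mem hA n)

/-- The bound `R` on `‖A_D‖` is uniform in `D`, so one polynomial close to `f` on `[-R, R]`
approximates all `f(A_D)` simultaneously. -/
lemma IsApproximable.calculus {A : OperatorFamily P} (hA : IsApproximable A)
    (hsa : ∀ D, IsSelfAdjoint (A D)) {f : ℝ → ℂ} (hf : Continuous f) :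
    IsApproximable (calculus A f) := by
  obtain ⟨R, hR0, hR⟩ := hA.bounded
  refine isApproximable_of_forall fun ε hε => ?_
  obtain ⟨q, hq⟩ := exists_complex_polynomial_near hf R hε
  refine ⟨_, hA.aeval q, fun D => ?_⟩
  have hn : IsStarNormal (A D) := (hsa D).isStarNormal
  have := D.nontrivial_L2
  rw [DeloneDOS.calculus, ← cfc_polynomial q (A D),
    ← cfc_sub (fun z : ℂ => f z.re) q.eval (A D) (by fun_prop) (by fun_prop)]
  refine norm_cfc_le hε.le fun z hz => ?_
  have hz' : z = (z.re : ℂ) := (hsa D).mem_spectrum_eq_re hz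
  have hzR : |z.re| ≤ R := (Complex.abs_re_le_norm z).trans
    ((spectrum.norm_le_norm_of_mem hz).trans (hR D))
  have h := hq z.re (abs_le.1 hzR)
  rwa [← hz'] at h

end Algebra

lemma integrable_of_continuous {X E : Type*} [TopologicalSpace X] [CompactSpace X] [T2Space X]
    [MeasurableSpace X] [BorelSpace X] [NormedAddCommGroup E] {μ : Measure X} [IsFiniteMeasure μ]
    {f : X → E} (hf : Continuous f) : Integrable f μ :=
  hf.integrable_of_hasCompactSupport (HasCompactSupport.of_compactSpace f)

/-! ### Weighted traces -/

section Traces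

variable {G : Type*} [Group G] [TopologicalSpace G] {P : DeloneParameters G}

/-- The weighted trace `∑ x ∈ D, ρ(x) ⟨δ_x, B_D δ_x⟩`. -/
def weightedTrace (B : OperatorFamily P) (ρ : G → ℝ) (D : DeloneSet P) : ℂ :=
  ∑' x : D.Pts, (ρ x.1 : ℂ) * entry B ⟨(x.1, D, x.1), x.2, x.2⟩

lemma localTrace_eq [IsTopologicalGroup G] (A : BoundedFamily P) (ρ : C_c(G, ℝ)) (φ : C_c(ℝ, ℂ)) :
    localTrace A ρ φ = weightedTrace (calculus (fun D => A D) φ) ρ := by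
  funext D
  refine tsum_congr fun x => ?_
  congr 1
  exact DeloneSet.inner_basisVec_left D x _

/-- The weighted trace is real and non-negative if the weight and the diagonal entries are. -/
lemma weightedTrace_nonneg {B : OperatorFamily P} {ρ : G → ℝ} (hρ : ∀ x, 0 ≤ ρ x) (D : DeloneSet P)
    (hB : ∀ (x : G) (hx : x ∈ D), ∃ r : ℝ, 0 ≤ r ∧ entry B ⟨(x, D, x), hx, hx⟩ = r) :
    0 ≤ (weightedTrace B ρ D).re := by
  choose r hr0 hr using hB
  have h : weightedTrace B ρ D = ((∑' x : D.Pts, ρ x.1 * r x.1 x.2 : ℝ) : ℂ) := by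
    rw [Complex.ofReal_tsum]
    exact tsum_congr fun x => by rw [hr x.1 x.2, Complex.ofReal_mul]
  rw [h, Complex.ofReal_re]
  exact tsum_nonneg fun x => mul_nonneg (hρ _) (hr0 _ _)

lemma ofReal_re_weightedTrace {B : OperatorFamily P} (ρ : G → ℝ) (D : DeloneSet P)
    (hB : ∀ (x : G) (hx : x ∈ D), ∃ r : ℝ, entry B ⟨(x, D, x), hx, hx⟩ = r) :
    (((weightedTrace B ρ D).re : ℝ) : ℂ) = weightedTrace B ρ D := by
  choose r hr using hB
  have h : weightedTrace B ρ D = ((∑' x : D.Pts, ρ x.1 * r x.1 x.2 : ℝ) : ℂ) := by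
    rw [Complex.ofReal_tsum]
    exact tsum_congr fun x => by rw [hr x.1 x.2, Complex.ofReal_mul]
  rw [h, Complex.ofReal_re]

lemma weightedTrace_smul_left (c : ℂ) (B : OperatorFamily P) (ρ : G → ℝ) (D : DeloneSet P) :
    weightedTrace (c • B) ρ D = c * weightedTrace B ρ D := by
  rw [weightedTrace, weightedTrace, ← tsum_mul_left]
  exact tsum_congr fun x => by rw [entry_smul, Pi.smul_apply, smul_eq_mul, mul_left_comm]

lemma weightedTrace_smul_right (c : ℝ) (B : OperatorFamily P) (ρ : G → ℝ) (D : DeloneSet P) :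
    weightedTrace B (fun x => c * ρ x) D = c * weightedTrace B ρ D := by
  rw [weightedTrace, weightedTrace, ← tsum_mul_left]
  exact tsum_congr fun x => by rw [Complex.ofReal_mul, mul_assoc]

variable [IsTopologicalGroup G]

lemma summable_weightedTrace (B : OperatorFamily P) (ρ : C_c(G, ℝ)) (D : DeloneSet P) :
    Summable fun x : D.Pts => (ρ x.1 : ℂ) * entry B ⟨(x.1, D, x.1), x.2, x.2⟩ := by
  have hfin := D.finite_inter ρ.hasCompactSupport
  refine summable_of_hasFiniteSupport ((hfin.preimage Subtype.val_injective.injOn).subset ?_)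
  intro x hx
  refine ⟨x.2, subset_tsupport _ fun h => hx ?_⟩
  simp only [h, Complex.ofReal_zero, zero_mul]

lemma weightedTrace_add_left (B C : OperatorFamily P) (ρ : C_c(G, ℝ)) (D : DeloneSet P) :
    weightedTrace (B + C) ρ D = weightedTrace B ρ D + weightedTrace C ρ D := by
  rw [weightedTrace, weightedTrace, weightedTrace,
    ← (summable_weightedTrace B ρ D).tsum_add (summable_weightedTrace C ρ D)]
  exact tsum_congr fun x => by rw [entry_add, Pi.add_apply, mul_add]

lemma weightedTrace_add_right (B : OperatorFamily P) (ρ ρ' : C_c(G, ℝ)) (D : DeloneSet P) :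
    weightedTrace B (fun x => ρ x + ρ' x) D = weightedTrace B ρ D + weightedTrace B ρ' D := by
  rw [weightedTrace, weightedTrace, weightedTrace,
    ← (summable_weightedTrace B ρ D).tsum_add (summable_weightedTrace B ρ' D)]
  exact tsum_congr fun x => by rw [Complex.ofReal_add, add_mul]

variable [LocallyCompactSpace G] [T2Space G]

lemma weightedTrace_smul {B : OperatorFamily P} (hB : IsApproximable B) (ρ : G → ℝ) (g : G)
    (D : DeloneSet P) :
    weightedTrace B ρ (g • D) = weightedTrace B (fun x => ρ (g * x)) D := by
  rw [weightedTrace, ← (DeloneSet.ptsEquiv g D).tsum_eq]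
  exact tsum_congr fun x => congrArg _ (hB.invariant g ⟨(x.1, D, x.1), x.2, x.2⟩)

/-- The compact support of `ρ` confines the sum, so continuity of the entries suffices. -/
lemma continuous_weightedTrace {B : OperatorFamily P} (hB : IsApproximable B) (ρ : C_c(G, ℝ)) :
    Continuous (weightedTrace B ρ) := by
  refine continuous_tsum_pts continuous_id
    (fun q => (ρ q.1.2 : ℂ) * entry B ⟨(q.1.2, q.1.1, q.1.2), q.2, q.2⟩) ?_ fun D =>
    ⟨tsupport ρ, ρ.hasCompactSupport, Eventually.of_forall fun D' z hz hzρ => ?_⟩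
  · refine Continuous.mul (by fun_prop) (hB.continuous_entry.comp ?_)
    exact Continuous.subtype_mk (by fun_prop) _
  · simp only [image_eq_zero_of_notMem_tsupport hzρ, Complex.ofReal_zero, zero_mul]

/-! ### Independence of the weight -/

variable [MeasurableSpace G] [BorelSpace G]

/-- Non-negative diagonal entries make the mean trace a positive functional of `ρ`, represented by a
measure on `G`. Invariance of `μ` and of the entries makes this measure left invariant, and
uniqueness of Haar measure provides `c`. -/
lemma exists_integral_weightedTrace_eq_of_nonneg (m : Measure G) [m.IsHaarMeasure]
    (μ : Measure (DeloneSet P)) [IsFiniteMeasure μ] (hμ : ∀ g : G, μ.map (fun D => g • D) = μ)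
    {B : OperatorFamily P} (hB : IsApproximable B)
    (hB0 : ∀ (D : DeloneSet P) (x : G) (hx : x ∈ D),
      ∃ r : ℝ, 0 ≤ r ∧ entry B ⟨(x, D, x), hx, hx⟩ = r) :
    ∃ c : ℂ, ∀ ρ : C_c(G, ℝ), ∫ D, weightedTrace B ρ D ∂μ = c * ((∫ x, ρ x ∂m : ℝ) : ℂ) := by
  have hint : ∀ ρ : C_c(G, ℝ), Integrable (fun D => (weightedTrace B ρ D).re) μ := fun ρ =>
    integrable_of_continuous (Complex.continuous_re.comp (continuous_weightedTrace hB ρ))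
  let Λ : C_c(G, ℝ) →ₚ[ℝ] ℝ := PositiveLinearMap.mk₀
    { toFun := fun ρ => ∫ D, (weightedTrace B ρ D).re ∂μ
      map_add' := fun ρ ρ' => by
        rw [← integral_add (hint ρ) (hint ρ')]
        exact integral_congr_ae (Eventually.of_forall fun D =>
          congrArg Complex.re (weightedTrace_add_right B ρ ρ' D))
      map_smul' := fun c ρ => by
        rw [RingHom.id_apply, smul_eq_mul, ← integral_const_mul]
        refine integral_congr_ae (Eventually.of_forall fun D => ?_)
        exact (congrArg Complex.re (weightedTrace_smul_right c B ρ D)).trans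
          (Complex.re_ofReal_mul _ _) }
    (fun ρ hρ => integral_nonneg fun D => weightedTrace_nonneg hρ D (hB0 D))
  have hΛ : ∀ ρ, Λ ρ = ∫ D, (weightedTrace B ρ D).re ∂μ := fun ρ => rfl
  let ν := RealRMK.rieszMeasure Λ
  have hreg : ν.Regular := RealRMK.regular_rieszMeasure Λ
  have hinv : ν.IsMulLeftInvariant := by
    refine ⟨fun g => ?_⟩
    have : (ν.map (g * ·)).Regular := Measure.Regular.map (Homeomorph.mulLeft g)
    refine Measure.ext_of_integral_eq_on_compactlySupported fun f => ?_
    rw [integral_map (by fun_prop) (by fun_prop)]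
    have h : ∀ x, f (g * x) = f.comp (Homeomorph.mulLeft g).toCocompactMap x := fun x => rfl
    simp_rw [h, ν, RealRMK.integral_rieszMeasure, hΛ]
    have hcont := Complex.continuous_re.comp (continuous_weightedTrace hB f)
    have hmap := integral_map (μ := μ) (φ := fun D => g • D)
      (DeloneSet.continuous_smul g).measurable.aemeasurable
      (f := fun D => (weightedTrace B f D).re)
      (integrable_of_continuous hcont).aestronglyMeasurable
    rw [hμ g] at hmap
    rw [hmap]
    exact integral_congr_ae (Eventually.of_forall fun D =>
      congrArg Complex.re (weightedTrace_smul hB f g D).symm)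
  obtain ⟨c, hc⟩ :=
    Measure.exists_integral_isMulLeftInvariant_eq_smul_of_hasCompactSupport ν m
  refine ⟨((c : ℝ) : ℂ), fun ρ => ?_⟩
  have h1 : ∫ x, ρ x ∂ν = ∫ D, (weightedTrace B ρ D).re ∂μ := RealRMK.integral_rieszMeasure Λ ρ
  rw [hc ρ ρ.continuous ρ.hasCompactSupport, integral_smul_nnreal_measure] at h1
  have h2 : ∫ D, weightedTrace B ρ D ∂μ = ((∫ D, (weightedTrace B ρ D).re ∂μ : ℝ) : ℂ) := by
    rw [← integral_complex_ofReal]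
    exact integral_congr_ae (Eventually.of_forall fun D => (ofReal_re_weightedTrace ρ D
      fun x hx => (hB0 D x hx).imp fun _ h => h.2).symm)
  rw [h2, ← h1, NNReal.smul_def, smul_eq_mul, Complex.ofReal_mul]

/-- The mean weighted trace of `f(A)` depends on the weight only through its Haar integral. -/
lemma exists_integral_weightedTrace_calculus_eq (m : Measure G) [m.IsHaarMeasure]
    (μ : Measure (DeloneSet P)) [IsFiniteMeasure μ] (hμ : ∀ g : G, μ.map (fun D => g • D) = μ)
    {A : OperatorFamily P} (hA : IsApproximable A) (hsa : ∀ D, IsSelfAdjoint (A D))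
    {f : ℝ → ℂ} (hf : Continuous f) :
    ∃ c : ℂ, ∀ ρ : C_c(G, ℝ),
      ∫ D, weightedTrace (calculus A f) ρ D ∂μ = c * ((∫ x, ρ x ∂m : ℝ) : ℂ) := by
  have hadd : ∀ f g : ℝ → ℂ, Continuous f → Continuous g →
      (∃ c : ℂ, ∀ ρ : C_c(G, ℝ),
        ∫ D, weightedTrace (calculus A f) ρ D ∂μ = c * ((∫ x, ρ x ∂m : ℝ) : ℂ)) →
      (∃ c : ℂ, ∀ ρ : C_c(G, ℝ),
        ∫ D, weightedTrace (calculus A g) ρ D ∂μ = c * ((∫ x, ρ x ∂m : ℝ) : ℂ)) →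
      ∃ c : ℂ, ∀ ρ : C_c(G, ℝ), ∫ D, weightedTrace (calculus A fun t => f t + g t) ρ D ∂μ =
        c * ((∫ x, ρ x ∂m : ℝ) : ℂ) := by
    rintro f g hf hg ⟨c, hc⟩ ⟨d, hd⟩
    refine ⟨c + d, fun ρ => ?_⟩
    rw [calculus_add A hsa hf hg, add_mul, ← hc, ← hd, ← integral_add
      (integrable_of_continuous (continuous_weightedTrace (hA.calculus hsa hf) ρ))
      (integrable_of_continuous (continuous_weightedTrace (hA.calculus hsa hg) ρ))]
    simp only [weightedTrace_add_left]
  have hsmul : ∀ (f : ℝ → ℝ) (z : ℂ), Continuous f →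
      ∃ c : ℂ, ∀ ρ : C_c(G, ℝ),
        ∫ D, weightedTrace (calculus A fun t => z * ((max (f t) 0 : ℝ) : ℂ)) ρ D ∂μ =
          c * ((∫ x, ρ x ∂m : ℝ) : ℂ) := by
    intro f z hf
    have hf' : Continuous fun t => max (f t) 0 := by fun_prop
    obtain ⟨c, hc⟩ := exists_integral_weightedTrace_eq_of_nonneg m μ hμ
      (hA.calculus hsa (f := fun t => ((max (f t) 0 : ℝ) : ℂ)) (by fun_prop))
      fun D x hx => entry_calculus_nonneg A hsa hf' (fun t => le_max_right _ _) hx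
    refine ⟨z * c, fun ρ => ?_⟩
    rw [calculus_smul A z (by fun_prop)]
    simp only [weightedTrace_smul_left]
    rw [integral_const_mul, hc, mul_assoc]
  -- The Riesz argument needs positivity, so `f` is split into the positive and negative parts of
  -- its real and imaginary parts.
  have hdecomp : f = fun t => (1 * ((max (f t).re 0 : ℝ) : ℂ) +
      (-1) * ((max (-(f t).re) 0 : ℝ) : ℂ)) + (Complex.I * ((max (f t).im 0 : ℝ) : ℂ) +
      (-Complex.I) * ((max (-(f t).im) 0 : ℝ) : ℂ)) := by
    funext t
    have hmax : ∀ r : ℝ, ((max r 0 : ℝ) : ℂ) - ((max (-r) 0 : ℝ) : ℂ) = r := fun r => by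
      rw [← Complex.ofReal_sub, max_zero_sub_eq_self]
    conv_lhs => rw [← Complex.re_add_im (f t), ← hmax (f t).re, ← hmax (f t).im]
    ring
  rw [hdecomp]
  exact hadd _ _ (by fun_prop) (by fun_prop)
    (hadd _ _ (by fun_prop) (by fun_prop) (hsmul _ _ (by fun_prop)) (hsmul _ _ (by fun_prop)))
    (hadd _ _ (by fun_prop) (by fun_prop) (hsmul _ _ (by fun_prop)) (hsmul _ _ (by fun_prop)))

end Traces

/-! ### Existence and uniqueness of the density of states -/

section Existence

lemma integral_eq_re_add_im (η : Measure ℝ) [IsLocallyFiniteMeasure η] (φ : C_c(ℝ, ℂ)) :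
    ∫ t, φ t ∂η = ((∫ t, (φ t).re ∂η : ℝ) : ℂ) + Complex.I * ((∫ t, (φ t).im ∂η : ℝ) : ℂ) := by
  have h := φ.continuous.integrable_of_hasCompactSupport (μ := η) φ.hasCompactSupport
  rw [← integral_complex_ofReal, ← integral_complex_ofReal, ← integral_const_mul,
    ← integral_add h.re.ofReal (h.im.ofReal.const_mul _)]
  exact integral_congr_ae (Eventually.of_forall fun t => by
    change φ t = ((φ t).re : ℂ) + Complex.I * ((φ t).im : ℂ)
    rw [mul_comm, Complex.re_add_im])

/-- A function in `C_c(ℝ, ℝ)`, seen as a function in `C_c(ℝ, ℂ)`. -/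
def complexify (f : C_c(ℝ, ℝ)) : C_c(ℝ, ℂ) :=
  ⟨⟨fun t => (f t : ℂ), by fun_prop⟩,
    f.hasCompactSupport.comp_left (g := fun r : ℝ => (r : ℂ)) Complex.ofReal_zero⟩

/-- The real part of a function in `C_c(ℝ, ℂ)`. -/
def realPart (φ : C_c(ℝ, ℂ)) : C_c(ℝ, ℝ) :=
  ⟨⟨fun t => (φ t).re, by fun_prop⟩, φ.hasCompactSupport.comp_left (g := Complex.re) rfl⟩

/-- The imaginary part of a function in `C_c(ℝ, ℂ)`. -/
def imagPart (φ : C_c(ℝ, ℂ)) : C_c(ℝ, ℝ) :=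
  ⟨⟨fun t => (φ t).im, by fun_prop⟩, φ.hasCompactSupport.comp_left (g := Complex.im) rfl⟩

lemma exists_nonneg_integral_eq_one {G : Type*} [Group G] [TopologicalSpace G]
    [IsTopologicalGroup G] [LocallyCompactSpace G] [T2Space G] [MeasurableSpace G] [BorelSpace G]
    (m : Measure G) [m.IsHaarMeasure] :
    ∃ ρ : C_c(G, ℝ), (∀ x, 0 ≤ ρ x) ∧ ∫ x, ρ x ∂m = 1 := by
  obtain ⟨f, hf, hf0, hf1⟩ := exists_continuous_nonneg_pos (1 : G)
  have hpos : 0 < ∫ x, f x ∂m :=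
    f.continuous.integral_pos_of_hasCompactSupport_nonneg_nonzero hf hf0 hf1
  refine ⟨(∫ x, f x ∂m)⁻¹ • (⟨f, hf⟩ : C_c(G, ℝ)),
    fun x => mul_nonneg (inv_nonneg.2 hpos.le) (hf0 x), ?_⟩
  have h : ∀ x, ((∫ x, f x ∂m)⁻¹ • (⟨f, hf⟩ : C_c(G, ℝ))) x = (∫ x, f x ∂m)⁻¹ * f x := fun x => rfl
  simp only [h]
  rw [integral_const_mul, inv_mul_cancel₀ hpos.ne']

variable {G : Type*} [Group G] [TopologicalSpace G] [IsTopologicalGroup G] {P : DeloneParameters G}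

lemma IsInvariantProbability.restrict_eq {Ω : Closeds (DeloneSet P)} {μ : Measure (DeloneSet P)}
    (hμ : IsInvariantProbability Ω μ) : μ.restrict (Ω : Set (DeloneSet P)) = μ :=
  Measure.restrict_eq_self_of_ae_mem (mem_ae_iff.2 hμ.compl_eq_zero)

variable [LocallyCompactSpace G] [T2Space G]

/-- A single weight already fixes the integrals of all real functions in `C_c(ℝ)`, and these
determine a locally finite measure on `ℝ`. -/
lemma IsDensityOfStates.unique [MeasurableSpace G] [BorelSpace G] {m : Measure G} [m.IsHaarMeasure]
    {Ω : Closeds (DeloneSet P)} {μ : Measure (DeloneSet P)} {A : BoundedFamily P}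
    {η η' : Measure ℝ} (h : IsDensityOfStates m Ω μ A η) (h' : IsDensityOfStates m Ω μ A η') :
    η = η' := by
  have := h.isLocallyFiniteMeasure
  have := h'.isLocallyFiniteMeasure
  obtain ⟨ρ, hρ0, hρ1⟩ := exists_nonneg_integral_eq_one m
  refine Measure.ext_of_integral_eq_on_compactlySupported fun f => ?_
  have key := (h.integral_eq ρ hρ0 hρ1 (complexify f)).trans
    (h'.integral_eq ρ hρ0 hρ1 (complexify f)).symm
  have hc : ∀ t, complexify f t = (f t : ℂ) := fun t => rfl
  simp only [hc, integral_complex_ofReal] at key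
  exact_mod_cast key

/-- A measure on `ℝ` representing the mean weighted traces of the functional calculus. -/
lemma exists_measure_integral_eq (μ : Measure (DeloneSet P)) [IsFiniteMeasure μ]
    {A : OperatorFamily P} (hA : IsApproximable A) (hsa : ∀ D, IsSelfAdjoint (A D))
    (ρ : C_c(G, ℝ)) (hρ : ∀ x, 0 ≤ ρ x) :
    ∃ η : Measure ℝ, IsLocallyFiniteMeasure η ∧
      ∀ φ : C_c(ℝ, ℂ), ∫ t, φ t ∂η = ∫ D, weightedTrace (calculus A φ) ρ D ∂μ := by
  have hap : ∀ f : C_c(ℝ, ℝ), IsApproximable (calculus A fun t => (f t : ℂ)) := fun f =>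
    hA.calculus hsa (by fun_prop)
  have hint' : ∀ f : C_c(ℝ, ℝ), Integrable (weightedTrace (calculus A fun t => (f t : ℂ)) ρ) μ :=
    fun f => integrable_of_continuous (continuous_weightedTrace (hap f) ρ)
  have hint : ∀ f : C_c(ℝ, ℝ),
      Integrable (fun D => (weightedTrace (calculus A fun t => (f t : ℂ)) ρ D).re) μ := fun f =>
    (hint' f).re
  let Λ : C_c(ℝ, ℝ) →ₚ[ℝ] ℝ := PositiveLinearMap.mk₀
    { toFun := fun f => ∫ D, (weightedTrace (calculus A fun t => (f t : ℂ)) ρ D).re ∂μ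
      map_add' := fun f g => by
        rw [← integral_add (hint f) (hint g)]
        refine integral_congr_ae (Eventually.of_forall fun D => ?_)
        have h := calculus_add A hsa (f := fun t => (f t : ℂ)) (g := fun t => (g t : ℂ))
          (by fun_prop) (by fun_prop)
        simp only [CompactlySupportedContinuousMap.add_apply, Complex.ofReal_add, h,
          weightedTrace_add_left, Complex.add_re]
      map_smul' := fun c f => by
        rw [RingHom.id_apply, smul_eq_mul, ← integral_const_mul]
        refine integral_congr_ae (Eventually.of_forall fun D => ?_)
        have h := calculus_smul A (c : ℂ) (f := fun t => (f t : ℂ)) (by fun_prop)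
        simp only [CompactlySupportedContinuousMap.smul_apply, smul_eq_mul, Complex.ofReal_mul, h,
          weightedTrace_smul_left, Complex.re_ofReal_mul] }
    (fun f hf => integral_nonneg fun D => weightedTrace_nonneg hρ D
      fun x hx => entry_calculus_nonneg A hsa f.continuous hf hx)
  refine ⟨RealRMK.rieszMeasure Λ, ?_, fun φ => ?_⟩
  · have : (RealRMK.rieszMeasure Λ).Regular := RealRMK.regular_rieszMeasure Λ
    infer_instance
  have : (RealRMK.rieszMeasure Λ).Regular := RealRMK.regular_rieszMeasure Λ
  have hΛ : ∀ f : C_c(ℝ, ℝ), ((∫ t, f t ∂(RealRMK.rieszMeasure Λ) : ℝ) : ℂ) =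
      ∫ D, weightedTrace (calculus A fun t => (f t : ℂ)) ρ D ∂μ := by
    intro f
    rw [RealRMK.integral_rieszMeasure]
    refine Eq.trans integral_complex_ofReal.symm
      (integral_congr_ae (Eventually.of_forall fun D => ?_))
    exact ofReal_re_weightedTrace ρ D fun x hx => entry_calculus_real A hsa f.continuous hx
  -- The Riesz measure is known on real functions only; the complex case follows from linearity.
  rw [integral_eq_re_add_im]
  have h1 := hΛ (realPart φ)
  have h2 := hΛ (imagPart φ)
  refine (congrArg₂ (fun a b => a + Complex.I * b) h1 h2).trans ?_
  rw [← integral_const_mul, ← integral_add (hint' _) ((hint' _).const_mul _)]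
  refine integral_congr_ae (Eventually.of_forall fun D => ?_)
  have hφ : (φ : ℝ → ℂ) =
      fun t => (realPart φ t : ℂ) + Complex.I * (imagPart φ t : ℂ) := by
    funext t
    change φ t = ((φ t).re : ℂ) + Complex.I * ((φ t).im : ℂ)
    rw [mul_comm, Complex.re_add_im]
  conv_rhs => rw [hφ]
  simp only
  rw [calculus_add A hsa (by fun_prop) (by fun_prop), calculus_smul A _ (by fun_prop),
    ← weightedTrace_smul_left]
  exact (weightedTrace_add_left _ _ ρ D).symm

/-- The measure is built from one weight `ρ₀`. Any other weight of integral one gives the same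
means, since both equal the constant `c` attached to `φ`. -/
lemma exists_isDensityOfStates [MeasurableSpace G] [BorelSpace G] (m : Measure G) [m.IsHaarMeasure]
    {Ω : Closeds (DeloneSet P)} {μ : Measure (DeloneSet P)} (hμ : IsInvariantProbability Ω μ)
    {A : BoundedFamily P} (hA : IsApproximable fun D => A D) (hsa : ∀ D, IsSelfAdjoint (A D)) :
    ∃ η : Measure ℝ, IsDensityOfStates m Ω μ A η := by
  have := hμ.isProbabilityMeasure
  obtain ⟨ρ₀, hρ₀, hρ₁⟩ := exists_nonneg_integral_eq_one m
  obtain ⟨η, hη, h⟩ := exists_measure_integral_eq μ hA hsa ρ₀ hρ₀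
  refine ⟨η, hη, fun ρ _ _ φ => ?_, fun ρ _ hρ φ => ?_⟩
  · rw [localTrace_eq]
    exact (integrable_of_continuous
      (continuous_weightedTrace (hA.calculus hsa φ.continuous) ρ)).integrableOn
  · obtain ⟨c, hc⟩ :=
      exists_integral_weightedTrace_calculus_eq m μ hμ.invariant hA hsa (map_continuous φ)
    rw [h, hμ.restrict_eq, localTrace_eq, hc ρ₀, hc ρ, hρ, hρ₁]

end Existence

/-! ### Convergence of invariant measures -/

section Convergence

variable {G : Type*} [Group G] [TopologicalSpace G] [IsTopologicalGroup G] {P : DeloneParameters G}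
  [LocallyCompactSpace G] [T2Space G]

/-- A sequence of probability measures on a compact space converges along every ultrafilter to a
regular probability measure, tested against continuous functions. -/
lemma exists_regular_limit {X ι : Type*} [TopologicalSpace X] [CompactSpace X] [T2Space X]
    [MeasurableSpace X] [BorelSpace X] (μ : ι → Measure X) [∀ i, IsProbabilityMeasure (μ i)]
    (𝒰 : Ultrafilter ι) :
    ∃ ν : Measure X, ν.Regular ∧ IsProbabilityMeasure ν ∧
      ∀ f : X → ℝ, Continuous f → Tendsto (fun i => ∫ x, f x ∂(μ i)) 𝒰 (𝓝 (∫ x, f x ∂ν)) := by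
  have hint : ∀ (f : C_c(X, ℝ)) i, Integrable f (μ i) := fun f i =>
    integrable_of_continuous f.continuous
  have hlim : ∀ f : C_c(X, ℝ), ∃ r : ℝ, Tendsto (fun i => ∫ x, f x ∂(μ i)) 𝒰 (𝓝 r) := by
    intro f
    obtain ⟨M, hM⟩ := (isCompact_range (map_continuous f)).isBounded.exists_norm_le
    have hmem : ∀ i, ∫ x, f x ∂(μ i) ∈ Set.Icc (-M) M := fun i => by
      rw [Set.mem_Icc, ← abs_le, ← Real.norm_eq_abs]
      have h := norm_integral_le_of_norm_le_const (μ := μ i) (f := f)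
        (Eventually.of_forall fun x => hM _ ⟨x, rfl⟩)
      simpa using h
    -- The means of `f` stay in a compact interval, so they converge along the ultrafilter.
    obtain ⟨r, -, hr⟩ := isCompact_Icc.ultrafilter_le_nhds' (𝒰.map fun i => ∫ x, f x ∂(μ i))
      (Ultrafilter.mem_map.2 (Eventually.of_forall hmem))
    exact ⟨r, hr⟩
  choose Λ₀ hΛ₀ using hlim
  let Λ : C_c(X, ℝ) →ₚ[ℝ] ℝ := PositiveLinearMap.mk₀
    { toFun := Λ₀
      map_add' := fun f g => tendsto_nhds_unique (hΛ₀ (f + g))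
        (((hΛ₀ f).add (hΛ₀ g)).congr fun i => (integral_add (hint f i) (hint g i)).symm)
      map_smul' := fun c f => tendsto_nhds_unique (hΛ₀ (c • f))
        (((hΛ₀ f).const_mul c).congr fun i => (integral_const_mul c f).symm) }
    (fun f hf => ge_of_tendsto' (hΛ₀ f) fun i => integral_nonneg hf)
  have hν : ∀ f : X → ℝ, Continuous f →
      Tendsto (fun i => ∫ x, f x ∂(μ i)) 𝒰 (𝓝 (∫ x, f x ∂(RealRMK.rieszMeasure Λ))) := by
    intro f hf
    have h := RealRMK.integral_rieszMeasure Λ ⟨⟨f, hf⟩, HasCompactSupport.of_compactSpace f⟩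
    have h' := hΛ₀ ⟨⟨f, hf⟩, HasCompactSupport.of_compactSpace f⟩
    rw [show Λ₀ _ = _ from h.symm] at h'
    exact h'
  have hreg : (RealRMK.rieszMeasure Λ).Regular := RealRMK.regular_rieszMeasure Λ
  refine ⟨RealRMK.rieszMeasure Λ, hreg, ?_, hν⟩
  have h1 := tendsto_nhds_unique (hν (fun _ => 1) continuous_const)
    (tendsto_const_nhds.congr fun i => (by simp : (1 : ℝ) = ∫ _, 1 ∂(μ i)))
  simp only [integral_const, smul_eq_mul, mul_one] at h1
  exact ⟨(ENNReal.toReal_eq_one_iff _).1 h1⟩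

/-- Invariant probability measures on systems converging to a uniquely ergodic system converge
weakly. -/
lemma IsUniquelyErgodic.tendsto_integral {Ω : Closeds (DeloneSet P)} {μ : Measure (DeloneSet P)}
    (hμ : IsUniquelyErgodic Ω μ) {Ωl : ℕ → Closeds (DeloneSet P)}
    {μl : ℕ → Measure (DeloneSet P)} (hμl : ∀ l, IsInvariantProbability (Ωl l) (μl l))
    (hlim : Tendsto Ωl atTop (@nhds _ (chabautyFell (DeloneSet P)) Ω))
    {f : DeloneSet P → ℝ} (hf : Continuous f) :
    Tendsto (fun l => ∫ D, f D ∂(μl l)) atTop (𝓝 (∫ D, f D ∂μ)) := by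
  have hprob : ∀ l, IsProbabilityMeasure (μl l) := fun l => (hμl l).isProbabilityMeasure
  -- Every ultrafilter finer than `atTop` yields a limit measure `ν`; it suffices to show `ν = μ`.
  rw [tendsto_iff_ultrafilter]
  intro 𝒰 h𝒰
  obtain ⟨ν, hreg, hν, htend⟩ := exists_regular_limit μl 𝒰
  have hinv : ∀ g : G, ν.map (fun D => g • D) = ν := by
    intro g
    have : (ν.map fun D => g • D).Regular :=
      Measure.Regular.map (DeloneSet.smulHomeomorph (P := P) g)
    refine Measure.ext_of_integral_eq_on_compactlySupported fun h => ?_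
    rw [integral_map (DeloneSet.continuous_smul g).measurable.aemeasurable
      (integrable_of_continuous (map_continuous h)).aestronglyMeasurable]
    refine tendsto_nhds_unique
      (htend _ (h.continuous.comp (DeloneSet.continuous_smul g))) ?_
    refine (htend h h.continuous).congr fun l => ?_
    conv_lhs => rw [← (hμl l).invariant g]
    rw [integral_map (DeloneSet.continuous_smul g).measurable.aemeasurable
      (integrable_of_continuous (map_continuous h)).aestronglyMeasurable]
  have hcompl : ν (Ω : Set (DeloneSet P))ᶜ = 0 := by
    -- By inner regularity of `ν` it suffices to treat compact sets `C` disjoint from `Ω`.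
    rw [Ω.isClosed.isOpen_compl.measure_eq_iSup_isCompact]
    simp only [ENNReal.iSup_eq_zero]
    intro C hCΩ hC
    -- A Urysohn function equal to 1 on `C`, with compact support disjoint from `Ω`. Eventually `Ωl`
    -- misses this support, so the means of `h` vanish and `ν C = 0`.
    obtain ⟨h, h1, hcpt, hsub, h01⟩ :=
      exists_continuousMap_one_of_isCompact_subset_isOpen hC Ω.isClosed.isOpen_compl hCΩ
    have hev : ∀ᶠ l in atTop, tsupport h ∩ (Ωl l : Set (DeloneSet P)) = ∅ := by
      have hmem := hlim (@IsOpen.mem_nhds _ (chabautyFell (DeloneSet P)) Ω _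
        (isOpen_generateFrom_of_mem ⟨tsupport h, ∅, hcpt, Set.finite_empty, by simp, rfl⟩)
        ⟨Set.eq_empty_iff_forall_notMem.2 fun D hD => hsub hD.1 hD.2, by simp⟩)
      filter_upwards [hmem] with l hl
      exact hl.1
    have hzero : ∫ D, h D ∂ν = 0 := by
      refine tendsto_nhds_unique (htend h h.continuous) (tendsto_const_nhds.congr' ?_)
      filter_upwards [h𝒰 hev] with l hl
      rw [← (hμl l).restrict_eq]
      refine (setIntegral_eq_zero_of_forall_eq_zero fun D hD => ?_).symm
      refine image_eq_zero_of_notMem_tsupport fun hD' => ?_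
      exact Set.eq_empty_iff_forall_notMem.1 hl D ⟨hD', hD⟩
    have hae : h =ᵐ[ν] 0 := (integral_eq_zero_iff_of_nonneg (fun D => (h01 D).1)
      (integrable_of_continuous h.continuous)).1 hzero
    refine measure_mono_null (fun D hD => ?_) hae
    intro h0
    have := h1 hD
    rw [h0] at this
    exact zero_ne_one this
  rw [← hμ.eq_of_isInvariantProbability ν ⟨hν, hcompl, hinv⟩]
  exact htend f hf

lemma IsUniquelyErgodic.tendsto_integral_complex {Ω : Closeds (DeloneSet P)}
    {μ : Measure (DeloneSet P)} (hμ : IsUniquelyErgodic Ω μ) {Ωl : ℕ → Closeds (DeloneSet P)}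
    {μl : ℕ → Measure (DeloneSet P)} (hμl : ∀ l, IsInvariantProbability (Ωl l) (μl l))
    (hlim : Tendsto Ωl atTop (@nhds _ (chabautyFell (DeloneSet P)) Ω))
    {f : DeloneSet P → ℂ} (hf : Continuous f) :
    Tendsto (fun l => ∫ D, f D ∂(μl l)) atTop (𝓝 (∫ D, f D ∂μ)) := by
  have hsplit : ∀ ν : Measure (DeloneSet P), IsProbabilityMeasure ν → ∫ D, f D ∂ν =
      ((∫ D, (f D).re ∂ν : ℝ) : ℂ) + ((∫ D, (f D).im ∂ν : ℝ) : ℂ) * Complex.I := fun ν _ =>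
    (integral_re_add_im (integrable_of_continuous hf)).symm
  simp only [hsplit _ (hμl _).isProbabilityMeasure,
    hsplit μ hμ.isInvariantProbability.isProbabilityMeasure]
  have hre := hμ.tendsto_integral hμl hlim (Complex.continuous_re.comp hf)
  have him := hμ.tendsto_integral hμl hlim (Complex.continuous_im.comp hf)
  exact ((Complex.continuous_ofReal.tendsto _).comp hre).add
    (((Complex.continuous_ofReal.tendsto _).comp him).mul_const _)

end Convergence

end DeloneDOS

end

/-- Continuity of the density of states for Delone dynamical systems. -/
theorem corollary5p9 {G : Type*} [Group G] [TopologicalSpace G] [IsTopologicalGroup G]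
    [LocallyCompactSpace G] [SecondCountableTopology G] [T2Space G]
    [MeasurableSpace G] [BorelSpace G]
    (m : Measure G) [m.IsHaarMeasure] [m.IsMulRightInvariant]
    (P : DeloneDOS.DeloneParameters G)
    (Ω : Closeds (DeloneDOS.DeloneSet P)) (μ : Measure (DeloneDOS.DeloneSet P))
    (hΩ : DeloneDOS.IsDeloneSystem Ω) (hμ : DeloneDOS.IsUniquelyErgodic Ω μ)
    (Ωl : ℕ → Closeds (DeloneDOS.DeloneSet P)) (μl : ℕ → Measure (DeloneDOS.DeloneSet P))
    (hΩl : ∀ l, DeloneDOS.IsDeloneSystem (Ωl l))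
    (hμl : ∀ l, DeloneDOS.IsInvariantProbability (Ωl l) (μl l))
    (hlim : Tendsto Ωl atTop
      (@nhds _ (DeloneDOS.chabautyFell (DeloneDOS.DeloneSet P)) Ω))
    (A : DeloneDOS.BoundedFamily P) (hA : A ∈ DeloneDOS.randomBoundedOperators P)
    (hsa : IsSelfAdjoint A) :
    (∀ l, ∃! η : Measure ℝ, DeloneDOS.IsDensityOfStates m (Ωl l) (μl l) A η) ∧
    (∃! η : Measure ℝ, DeloneDOS.IsDensityOfStates m Ω μ A η) ∧
    ∀ (ηl : ℕ → Measure ℝ) (η : Measure ℝ),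
      (∀ l, DeloneDOS.IsDensityOfStates m (Ωl l) (μl l) A (ηl l)) →
      DeloneDOS.IsDensityOfStates m Ω μ A η →
      ∀ φ : C_c(ℝ, ℂ), Tendsto (fun l => ∫ t, φ t ∂(ηl l)) atTop (𝓝 (∫ t, φ t ∂η)) := by
  have hap := DeloneDOS.isApproximable_of_mem_randomBoundedOperators hA
  have hsaD : ∀ D, IsSelfAdjoint (A D) := fun D => by
    rw [isSelfAdjoint_iff, ← lp.star_apply, hsa.star_eq]
  refine ⟨fun l => ?_, ?_, fun ηl η hηl hη φ => ?_⟩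
  · obtain ⟨η, hη⟩ := DeloneDOS.exists_isDensityOfStates m (hμl l) hap hsaD
    exact ⟨η, hη, fun η' hη' => hη'.unique hη⟩
  · obtain ⟨η, hη⟩ := DeloneDOS.exists_isDensityOfStates m hμ.isInvariantProbability hap hsaD
    exact ⟨η, hη, fun η' hη' => hη'.unique hη⟩
  -- With one fixed weight, all the integrals of `φ` become means of the same continuous function of
  -- `D`, and weak convergence applies.
  · obtain ⟨ρ, hρ0, hρ1⟩ := DeloneDOS.exists_nonneg_integral_eq_one m
    simp only [fun l => (hηl l).integral_eq ρ hρ0 hρ1 φ, hη.integral_eq ρ hρ0 hρ1 φ,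
      fun l => (hμl l).restrict_eq, hμ.isInvariantProbability.restrict_eq,
      DeloneDOS.localTrace_eq]
    exact hμ.tendsto_integral_complex hμl hlim
      (DeloneDOS.continuous_weightedTrace (hap.calculus hsaD φ.continuous) ρ)
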